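/- Let $n\ge 1$ and $V=\{x\in\mathbb{R}^n:\sum_i x_i=0\}$. For an ordered set partition $S=(S_1,\dots,S_k)$ of $\{1,\dots,n\}$ let the plate $[S]\subset V$ be the cone given by $\sum_{i\in S_1\cup\cdots\cup S_j}x_i\ge 0$ for $1\le j\le k-1$. For a cone $C\subseteq V$ let $[C]$ be its characteristic function $V\to\mathbb{C}$, and $C^\star=\{y\in V:\langle y,x\rangle\ge 0\ \forall x\in C\}$ its dual; $C$ is pointed if it contains no line. Let $\hat{\mathcal P}^n$ be the complex span of the characteristic functions $[[S]]$ of all plates, $N$ the span of the characteristic functions of the plates that are not pointed, and $Z$ the subspace of the elements of $\hat{\mathcal P}^n$ that vanish outside a subset of measure zero of $V$. Put $\mathcal P^n=\hat{\mathcal P}^n/Z$, $\hat{\mathcal P}_1^n=\hat{\mathcal P}^n/N$ and $\mathcal P_1^n=\hat{\mathcal P}^n/(N+Z)$. For a lattice $\Lambda\subset V$ and a pointed polyhedral cone $C$ (finitely many linear inequalities with integer coefficients) let $\mathcal L_d^\Lambda(C)=\sum_{v\in C\cap\Lambda}e^{-\langle y,v\rangle}$ and $\mathcal L_{\mathcal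 I}(C)=\int_C e^{-\langle y,v\rangle}dv$, as functions of the $y\in\mathbb{R}^n$ that are positive on $C\setminus\{0\}$; here $dv$ is Lebesgue measure on $V$, normalized so that the root lattice $Q=V\cap\mathbb{Z}^n$ has covolume $1$. Let $W=\{v\in V: v_a-v_b\in\mathbb{Z}\ \forall a,b\}$ be the weight lattice, and $\bar y_I=\sum_{i\in I}y_i-\frac{|I|}{n}\sum_{i=1}^n y_i$. The functional representations of the three quotient spaces are well defined: 1. (Type $\mathcal P^n$.) There is a unique linear map $\Phi$ from $\mathcal P^n$ to the field of rational functions in the exponentials $e^{-\langle y,v\rangle}$, $v\in W$, such that $$\Phi([[S_1,\dots,S_k]])=\prod_{j=1}^{k-1}\frac{1}{1-e^{-\bar y_{S_1\cup\cdots\cup S_j}}}$$ for every ordered set partition and, for every polyhedral cone $C\subseteq V$ with $[C]\in\hat{\mathcal P}^n$: if $C^\star$ is pointed, then the series $\mathcal L_d^{W}(C^\star)$ converges to $\Phi([C])$; if $C^\star$ is not pointed, or if $C$ is not full-dimensional in $V$, then $\Phi([C])=0$. 2. (Type $\hat{\mathcal P}_1^n$.) There is a unique linear map $\Phi$ from $\hat{\mathcal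 P}_1^n$ to the field of rational functions in $x_i=e^{-y_i}$, $1\le i\le n$, such that $$\Phi([[i_1,\dots,i_n]])=\prod_{a=1}^{n-1}\frac{1}{1-x_{i_a}/x_{i_{a+1}}}$$ for every permutation $(i_1,\dots,i_n)$ and, for every polyhedral cone $C\subseteq V$ with $[C]\in\hat{\mathcal P}^n$: if $C$ is pointed, then the series $\mathcal L_d^{Q}(C)$ converges to $\Phi([C])$; if $C$ is not pointed, then $\Phi([C])=0$. 3. (Type $\mathcal P_1^n$.) There is a unique linear map $\Phi$ from $\mathcal P_1^n$ to the field of rational functions in $y_1,\dots,y_n$ such that $$\Phi([[i_1,\dots,i_n]])=\prod_{a=1}^{n-1}\frac{1}{y_{i_a}-y_{i_{a+1}}}$$ for every permutation $(i_1,\dots,i_n)$ and, for every polyhedral cone $C\subseteq V$ with $[C]\in\hat{\mathcal P}^n$: if $C$ is pointed, then the integral $\mathcal L_{\mathcal I}(C)$ converges to $\Phi([C])$; if $C$ is not pointed or not full-dimensional, then $\Phi([C])=0$. -/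

import Mathlib

open MeasureTheory

noncomputable section

/-- The hyperplane `x_1 + ⋯ + x_n = 0` of `ℝ^n`. -/
def V0 (n : ℕ) : Submodule ℝ (Fin n → ℝ) where
  carrier := {x | ∑ i, x i = 0}
  add_mem' := by
    intro x y hx hy
    simp only [Set.mem_ofPred_eq, Pi.add_apply, Finset.sum_add_distrib] at *
    rw [hx, hy, add_zero]
  zero_mem' := by simp
  smul_mem' := by
    intro c x hx
    simp only [Set.mem_ofPred_eq, Pi.smul_apply, smul_eq_mul] at *
    rw [← Finset.mul_sum, hx, mul_zero]

/-- The standard pairing `⟨y, v⟩` of `y ∈ ℝ^n` with `v` in the hyperplane. -/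
def pairing {n : ℕ} (y : Fin n → ℝ) (v : V0 n) : ℝ := ∑ i, y i * v.1 i

/-- The root `e_a - e_b`. -/
def root {n : ℕ} (a b : Fin n) : V0 n :=
  ⟨Pi.single a 1 - Pi.single b 1, by
    change ∑ i, (Pi.single a 1 - Pi.single b 1 : Fin n → ℝ) i = 0
    simp [Finset.sum_sub_distrib]⟩

/-- The projection `ē_I = e_I - (|I|/n)(1,…,1)` of `e_I` to the hyperplane along `(1,…,1)`. -/
def ebar {n : ℕ} (I : Finset (Fin n)) : V0 n :=
  ⟨fun a => (if a ∈ I then 1 else 0) - (I.card : ℝ) / n, by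
    change ∑ a, ((if a ∈ I then (1 : ℝ) else 0) - (I.card : ℝ) / n) = 0
    rcases Nat.eq_zero_or_pos n with rfl | hn
    · simp
    · have hn' : (n : ℝ) ≠ 0 := by exact_mod_cast hn.ne'
      rw [Finset.sum_sub_distrib]
      simp
      field_simp
      ring⟩

/-- The root lattice of type `A_{n-1}`: the integer points of the hyperplane. -/
def rootLattice (n : ℕ) : AddSubgroup (V0 n) where
  carrier := {v | ∀ a, ∃ m : ℤ, v.1 a = m}
  add_mem' := by
    intro v w hv hw a
    obtain ⟨k, hk⟩ := hv a
    obtain ⟨l, hl⟩ := hw a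
    exact ⟨k + l, by simp [hk, hl]⟩
  zero_mem' := fun a => ⟨0, by simp⟩
  neg_mem' := by
    intro v hv a
    obtain ⟨k, hk⟩ := hv a
    exact ⟨-k, by simp [hk]⟩

/-- The weight lattice of type `A_{n-1}`: the vectors of the hyperplane that pair integrally with
all roots `e_a - e_b`. -/
def weightLattice (n : ℕ) : AddSubgroup (V0 n) where
  carrier := {v | ∀ a b, ∃ m : ℤ, v.1 a - v.1 b = m}
  add_mem' := by
    intro v w hv hw a b
    obtain ⟨k, hk⟩ := hv a b
    obtain ⟨l, hl⟩ := hw a b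
    exact ⟨k + l, by push_cast; rw [← hk, ← hl]; simp; ring⟩
  zero_mem' := fun a b => ⟨0, by simp⟩
  neg_mem' := by
    intro v hv a b
    obtain ⟨k, hk⟩ := hv a b
    exact ⟨-k, by push_cast; rw [← hk]; simp; ring⟩

theorem ebar_mem_weightLattice {n : ℕ} (I : Finset (Fin n)) : ebar I ∈ weightLattice n := by
  intro a b
  refine ⟨(if a ∈ I then 1 else 0) - (if b ∈ I then 1 else 0), ?_⟩
  simp [ebar]

/-- `ē_I` as an element of the weight lattice. -/
def ebarWeight {n : ℕ} (I : Finset (Fin n)) : weightLattice n := ⟨ebar I, ebar_mem_weightLattice I⟩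

/-- The Lebesgue measure of the hyperplane, normalized so that the root lattice has covolume one:
the image of the Lebesgue measure of `ℝ^(n-1)` under `t ↦ ∑ t_i (e_i - e_{i+1})`. -/
def rootVolume (n : ℕ) : Measure (V0 n) :=
  Measure.map (fun t : Fin (n - 1) → ℝ =>
    ∑ i, t i • (root ⟨i, by omega⟩ ⟨i + 1, by omega⟩ : V0 n)) volume

/-! ### Cones -/

/-- A polyhedral cone of the hyperplane: an intersection of finitely many half spaces
`∑ a_{i,j} x_j ≥ 0` with integer coefficients. -/
def IsPolyhedralCone {n : ℕ} (C : Set (V0 n)) : Prop :=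
  ∃ (m : ℕ) (a : Fin m → Fin n → ℤ), C = {x | ∀ i, 0 ≤ ∑ j, (a i j : ℝ) * x.1 j}

/-- A cone is pointed if it contains no line. -/
def IsPointedCone {n : ℕ} (C : Set (V0 n)) : Prop :=
  ∀ x v : V0 n, (∀ t : ℝ, x + t • v ∈ C) → v = 0

/-- A cone is full-dimensional if it spans the hyperplane. -/
def IsFullDimensional {n : ℕ} (C : Set (V0 n)) : Prop := Submodule.span ℝ C = ⊤

/-- The dual cone, inside the hyperplane. -/
def dualConeV0 {n : ℕ} (C : Set (V0 n)) : Set (V0 n) := {y | ∀ x ∈ C, 0 ≤ pairing y.1 x}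

/-- The characteristic function `[C]`. -/
def charFn {n : ℕ} (C : Set (V0 n)) : V0 n → ℂ := C.indicator 1

/-! ### Plates -/

/-- An ordered set partition `(S_1,…,S_k)` of the `n` labels. -/
structure OrderedSetPartition (n : ℕ) where
  len : ℕ
  block : Fin len → Finset (Fin n)
  nonempty : ∀ i, (block i).Nonempty
  disjoint : ∀ i j, i ≠ j → Disjoint (block i) (block j)
  cover : ∀ a, ∃ i, a ∈ block i

namespace OrderedSetPartition

/-- The union `S_1 ∪ ⋯ ∪ S_j` of the first `j` blocks. -/
def head {n : ℕ} (S : OrderedSetPartition n) (j : ℕ) : Finset (Fin n) :=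
  ({i : Fin S.len | (i : ℕ) < j} : Finset (Fin S.len)).biUnion S.block

/-- The plate `[S_1,…,S_k]`. -/
def plate {n : ℕ} (S : OrderedSetPartition n) : Set (V0 n) :=
  {x | ∀ j ∈ Finset.Ico 1 S.len, 0 ≤ ∑ a ∈ S.head j, x.1 a}

/-- The ordered set partition `({σ_1},…,{σ_n})` into singlets. -/
def ofPerm {n : ℕ} (σ : Equiv.Perm (Fin n)) : OrderedSetPartition n where
  len := n
  block := fun i => {σ i}
  nonempty := fun i => Finset.singleton_nonempty _
  disjoint := fun i j h => by simpa using h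
  cover := fun a => ⟨σ.symm a, by simp⟩

end OrderedSetPartition

/-- The linear span of the characteristic functions of all plates. -/
def PHat (n : ℕ) : Submodule ℂ (V0 n → ℂ) :=
  Submodule.span ℂ (Set.range fun S : OrderedSetPartition n => charFn S.plate)

/-- The characteristic function of a plate, as an element of the span. -/
def plateFn {n : ℕ} (S : OrderedSetPartition n) : PHat n :=
  ⟨charFn S.plate, Submodule.subset_span ⟨S, rfl⟩⟩

/-- The elements of `PHat n` that vanish outside a set of measure zero. -/
def nullPart (n : ℕ) : Submodule ℂ (PHat n) where
  carrier := {f | ∀ᵐ x ∂rootVolume n, f.1 x = 0}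
  add_mem' := by
    intro f g (hf : ∀ᵐ x ∂rootVolume n, f.1 x = 0) (hg : ∀ᵐ x ∂rootVolume n, g.1 x = 0)
    change ∀ᵐ x ∂rootVolume n, (f + g).1 x = 0
    filter_upwards [hf, hg] with x hx hy
    simp [hx, hy]
  zero_mem' := by simp
  smul_mem' := by
    intro c f (hf : ∀ᵐ x ∂rootVolume n, f.1 x = 0)
    change ∀ᵐ x ∂rootVolume n, (c • f).1 x = 0
    filter_upwards [hf] with x hx
    simp [hx]

/-- The span of the characteristic functions of the plates that are not pointed. -/
def nonPointedPart (n : ℕ) : Submodule ℂ (PHat n) :=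
  Submodule.span ℂ {f | ∃ S : OrderedSetPartition n, ¬ IsPointedCone S.plate ∧ f = plateFn S}

/-- The quotient `𝓟^n` (lower-dimensional cones neglected). -/
abbrev P (n : ℕ) : Type := PHat n ⧸ nullPart n

/-- The quotient `𝓟̂_1^n` (non-pointed cones neglected). -/
abbrev PHatOne (n : ℕ) : Type := PHat n ⧸ nonPointedPart n

/-- The quotient `𝓟_1^n` (both neglected). -/
abbrev POne (n : ℕ) : Type := PHat n ⧸ (nonPointedPart n ⊔ nullPart n)

/-! ### Laplace transforms -/

/-- The weight lattice is torsion-free; hence its group algebra below is an integral domain. -/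
instance instTwoUniqueSumsWeightLattice (n : ℕ) : TwoUniqueSums (weightLattice n) :=
  TwoUniqueSums.of_injective_addHom
    (((V0 n).subtype.toAddMonoidHom.comp (weightLattice n).subtype : weightLattice n →+ _) :
      weightLattice n →ₙ+ (Fin n → ℝ))
    (fun _ _ h => Subtype.ext (Subtype.ext h)) inferInstance

/-- The group algebra of the weight lattice: finite linear combinations of the exponentials
`e^{-⟨y, v⟩}`, where `v` is a weight. -/
abbrev WeightAlgebra (n : ℕ) : Type := AddMonoidAlgebra ℂ (weightLattice n)

/-- The field of rational functions in the exponentials `e^{-⟨y, v⟩}`, where `v` is a weight. -/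
abbrev WeightField (n : ℕ) : Type := FractionRing (WeightAlgebra n)

/-- The field `ℂ(z_1,…,z_n)` of rational functions. -/
abbrev RatField (n : ℕ) : Type := FractionRing (MvPolynomial (Fin n) ℂ)

/-- The exponential `e^{-⟨y, v⟩}` of a weight `v`, as an element of `WeightField n`. -/
def weightExp {n : ℕ} (v : weightLattice n) : WeightField n :=
  algebraMap (WeightAlgebra n) (WeightField n) (AddMonoidAlgebra.single v 1)

/-- The variable `z_i`, as an element of `RatField n`. -/
def ratVar {n : ℕ} (i : Fin n) : RatField n :=
  algebraMap (MvPolynomial (Fin n) ℂ) (RatField n) (MvPolynomial.X i)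

/-- The value at `y ∈ ℝ^n` of a finite combination of exponentials `e^{-⟨y, v⟩}`. -/
def evalWeight {n : ℕ} (y : Fin n → ℝ) (p : WeightAlgebra n) : ℂ :=
  p.coeff.sum fun v c => c * Complex.exp (-(pairing y v.1 : ℂ))

/-- The value of a polynomial in the variables `x_i = e^{-y_i}`. -/
def evalExp {n : ℕ} (y : Fin n → ℝ) (p : MvPolynomial (Fin n) ℂ) : ℂ :=
  MvPolynomial.eval (fun i => Complex.exp (-(y i : ℂ))) p

/-- The value of a polynomial in the variables `y_i`. -/
def evalLin {n : ℕ} (y : Fin n → ℝ) (p : MvPolynomial (Fin n) ℂ) : ℂ :=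
  MvPolynomial.eval (fun i => (y i : ℂ)) p

/-- The domain of convergence of the Laplace transforms of a pointed polyhedral cone `C`: the
`y ∈ ℝ^n` that are positive on `C \ {0}`. -/
def convDomain {n : ℕ} (C : Set (V0 n)) : Set (Fin n → ℝ) :=
  {y | ∀ v ∈ C, v ≠ 0 → 0 < pairing y v}

/-- The rational function `F`, whose numerators and denominators (elements of `A`) are evaluated
by `ev`, is the discrete Laplace transform `∑_{v ∈ C ∩ Λ} e^{-⟨y, v⟩}` of the pointed cone `C`
with respect to the lattice `Λ`: the series converges for all `y` in the domain of convergence,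
and its sum is `F`. -/
def IsDiscreteLaplace {n : ℕ} {A : Type} [CommRing A] [IsDomain A] (ev : (Fin n → ℝ) → A → ℂ)
    (Λ : AddSubgroup (V0 n)) (C : Set (V0 n)) (F : FractionRing A) : Prop :=
  ∃ p q : A, q ≠ 0 ∧ F = algebraMap A (FractionRing A) p / algebraMap A (FractionRing A) q ∧
    ∀ y ∈ convDomain C, ∃ s : ℂ,
      HasSum (fun v : {v : V0 n // v ∈ C ∧ v ∈ Λ} => Complex.exp (-(pairing y v.1 : ℂ))) s ∧
      ev y q * s = ev y p

/-- The rational function `F` in the variables `y_i` is the integral Laplace transform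
`∫_C e^{-⟨y, v⟩} dv` of the pointed cone `C`: the integral converges for all `y` in the domain of
convergence, and its value is `F`. -/
def IsIntegralLaplace {n : ℕ} (C : Set (V0 n)) (F : RatField n) : Prop :=
  ∃ p q : MvPolynomial (Fin n) ℂ, q ≠ 0 ∧
    F = algebraMap _ (RatField n) p / algebraMap _ (RatField n) q ∧
    ∀ y ∈ convDomain C,
      IntegrableOn (fun v : V0 n => Complex.exp (-(pairing y v : ℂ))) C (rootVolume n) ∧
      evalLin y q * ∫ v in C, Complex.exp (-(pairing y v : ℂ)) ∂(rootVolume n) = evalLin y p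

end

noncomputable section

/-! ### Difference operators and regularized Laplace transforms -/

/-! All three maps come from one construction. Fix a measure `μ` (Lebesgue measure, or the counting
measure of a lattice) and a finite multiset `s` of translations preserving it. If the composite of
the operators `f ↦ f - f(· - r)`, `r ∈ s`, turns `f` into a bounded function with bounded support,
then the Laplace transform of the result converges for every `y`. Divided by `∏ (1 - e^{-⟨y, r⟩})`
it is the regularized transform `regLaplace` of `f`. It is linear in `f`, and off the zeros of the
denominator it equals the ordinary transform wherever that converges (`regLaplace_eq_integral`). It
kills functions that are null for `μ` (`regLaplace_congr_ae`). It kills functions with a nonzero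
period, because a boundedly supported periodic function is zero (`shiftDiffs_eq_zero_of_periodic`);
hence cones containing a line have transform zero. Such a map descends to the quotients.

For the quotients by non-pointed plates, `s` consists of all roots. A plate of singlets is a
simplicial cone on consecutive roots, and the difference operators of its rays cut it down to a
half-open parallelepiped. That contains only the origin of the root lattice, and its Lebesgue
integral factors, which gives the two product formulas. A plate with two labels `a`, `b` in one
block is invariant under `e_a - e_b`, so it is killed.

For `𝓟^n` the same is done after dualizing, with `s` the vectors `ē_I`. That `[C] ↦ [C⋆]` respects
linear relations is an Euler characteristic argument (`sum_charFn_dual_eq_zero`): `w ∉ C⋆` exactly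
when `C` meets `{⟨w, ·⟩ ≤ -1}`, and counting nonempty compact convex sets is a valuation
(`sum_nonempty_convex_eq_zero`). Null elements are supported on the hyperplanes `∑_{i ∈ I} x_i = 0`,
and duals of cones inside such a hyperplane have period `ē_I`, so they die too
(`shiftDiffs_plateDual_nullPart`).

The transforms so far are functions of `y`. `HasValues` ties them to fractions away from the zeros
of a discriminant `d`; a fraction with values zero there is zero, so linear relations pass to
fractions (`exists_quotient_linearMap_hasValues`). Uniqueness holds because the plates on which
values are prescribed span the quotient. -/

/-- The exponential `e^{-⟨y, v⟩}`. -/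
def expPair {n : ℕ} (y : Fin n → ℝ) (v : V0 n) : ℂ := Complex.exp (-(pairing y v : ℂ))

theorem pairing_add_right {n : ℕ} (y : Fin n → ℝ) (v w : V0 n) :
    pairing y (v + w) = pairing y v + pairing y w := by
  simp [pairing, mul_add, Finset.sum_add_distrib]

theorem pairing_smul_right {n : ℕ} (y : Fin n → ℝ) (c : ℝ) (v : V0 n) :
    pairing y (c • v) = c * pairing y v := by
  simp only [pairing, Finset.mul_sum]
  exact Finset.sum_congr rfl fun i _ => by simp; ring

theorem pairing_neg_right {n : ℕ} (y : Fin n → ℝ) (v : V0 n) :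
    pairing y (-v) = -pairing y v := by
  simp [pairing]

theorem pairing_sub_right {n : ℕ} (y : Fin n → ℝ) (v w : V0 n) :
    pairing y (v - w) = pairing y v - pairing y w := by
  rw [sub_eq_add_neg, pairing_add_right, pairing_neg_right, sub_eq_add_neg]

theorem continuous_pairing {n : ℕ} (y : Fin n → ℝ) : Continuous (pairing y) := by
  unfold pairing
  exact continuous_finsetSum _ fun i _ =>
    continuous_const.mul ((continuous_apply i).comp continuous_subtype_val)

theorem expPair_add {n : ℕ} (y : Fin n → ℝ) (v w : V0 n) :
    expPair y (v + w) = expPair y v * expPair y w := by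
  rw [expPair, expPair, expPair, ← Complex.exp_add, pairing_add_right]
  congr 1
  push_cast
  ring

theorem continuous_expPair {n : ℕ} (y : Fin n → ℝ) : Continuous (expPair y) := by
  have := continuous_pairing y
  unfold expPair
  fun_prop

theorem norm_expPair {n : ℕ} (y : Fin n → ℝ) (v : V0 n) :
    ‖expPair y v‖ = Real.exp (-pairing y v) := by
  rw [expPair, Complex.norm_exp]
  simp

theorem expPair_eq_one_iff {n : ℕ} (y : Fin n → ℝ) (v : V0 n) :
    expPair y v = 1 ↔ pairing y v = 0 := by
  constructor
  · intro h
    have := norm_expPair y v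
    rw [h, norm_one, eq_comm, Real.exp_eq_one_iff] at this
    linarith
  · intro h
    simp [expPair, h]

theorem abs_pairing_le {n : ℕ} (y : Fin n → ℝ) (v : V0 n) :
    |pairing y v| ≤ (∑ i, |y i|) * ‖v‖ := by
  rw [pairing, Finset.sum_mul]
  refine (Finset.abs_sum_le_sum_abs _ _).trans (Finset.sum_le_sum fun i _ => ?_)
  rw [abs_mul]
  exact mul_le_mul_of_nonneg_left (norm_le_pi_norm v.1 i) (abs_nonneg _)

/-- The difference operator `f ↦ f - f(· - r)`. -/
def shiftDiff {n : ℕ} (r : V0 n) (f : V0 n → ℂ) : V0 n → ℂ := fun v => f v - f (v - r)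

/-- Commutation of the difference operators is what makes their composition over a multiset
meaningful. -/
instance instLeftCommutativeShiftDiff {n : ℕ} : LeftCommutative (shiftDiff (n := n)) where
  left_comm r t f := by
    funext v
    simp only [shiftDiff, sub_right_comm v t r]
    ring

/-- The composition of the difference operators of the vectors in `s`. -/
def shiftDiffs {n : ℕ} (s : Multiset (V0 n)) (f : V0 n → ℂ) : V0 n → ℂ := s.foldr shiftDiff f

theorem shiftDiffs_cons {n : ℕ} (r : V0 n) (s : Multiset (V0 n)) (f : V0 n → ℂ) :
    shiftDiffs (r ::ₘ s) f = shiftDiff r (shiftDiffs s f) := Multiset.foldr_cons _ _ _ _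

theorem shiftDiffs_zero {n : ℕ} (f : V0 n → ℂ) : shiftDiffs 0 f = f := rfl

theorem shiftDiffs_union {n : ℕ} (s t : Multiset (V0 n)) (f : V0 n → ℂ) :
    shiftDiffs (s + t) f = shiftDiffs s (shiftDiffs t f) := Multiset.foldr_add _ _ _ _

theorem shiftDiffs_add {n : ℕ} (s : Multiset (V0 n)) (f g : V0 n → ℂ) :
    shiftDiffs s (f + g) = shiftDiffs s f + shiftDiffs s g := by
  induction s using Multiset.induction with
  | empty => rfl
  | cons r s ih =>
    rw [shiftDiffs_cons, shiftDiffs_cons, shiftDiffs_cons, ih]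
    funext v
    simp only [shiftDiff, Pi.add_apply]
    ring

theorem shiftDiffs_smul {n : ℕ} (s : Multiset (V0 n)) (c : ℂ) (f : V0 n → ℂ) :
    shiftDiffs s (c • f) = c • shiftDiffs s f := by
  induction s using Multiset.induction with
  | empty => rfl
  | cons r s ih =>
    rw [shiftDiffs_cons, shiftDiffs_cons, ih]
    funext v
    simp only [shiftDiff, Pi.smul_apply, smul_eq_mul]
    ring

theorem shiftDiffs_zero_fun {n : ℕ} (s : Multiset (V0 n)) : shiftDiffs s 0 = 0 := by
  simpa using shiftDiffs_smul s 0 0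

/-- By commutation the operator of `r` can be applied first, where it annihilates a function of
period `r`. -/
theorem shiftDiffs_eq_zero_of_mem {n : ℕ} {s : Multiset (V0 n)} {r : V0 n} (hr : r ∈ s)
    {f : V0 n → ℂ} (hf : ∀ v, f (v - r) = f v) : shiftDiffs s f = 0 := by
  obtain ⟨t, rfl⟩ := Multiset.exists_cons_of_mem hr
  rw [← Multiset.singleton_add, add_comm, shiftDiffs_union]
  have : shiftDiffs {r} f = 0 := by
    rw [← Multiset.cons_zero, shiftDiffs_cons, shiftDiffs_zero]
    funext v
    simp [shiftDiff, hf]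
  rw [this, shiftDiffs_zero_fun]

theorem shiftDiffs_periodic {n : ℕ} (s : Multiset (V0 n)) {w : V0 n} {f : V0 n → ℂ}
    (hf : ∀ v, f (v + w) = f v) (v : V0 n) : shiftDiffs s f (v + w) = shiftDiffs s f v := by
  induction s using Multiset.induction generalizing v with
  | empty => exact hf v
  | cons r s ih => simp only [shiftDiffs_cons, shiftDiff, add_sub_right_comm, ih]

/-! ### Functions with bounded support -/

/-- Bounded measurable functions with bounded support. -/
structure IsBoundedlySupported {n : ℕ} (g : V0 n → ℂ) : Prop where
  measurable : Measurable g
  bounded : ∃ M, ∀ v, ‖g v‖ ≤ M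
  support : ∃ R, ∀ v, g v ≠ 0 → ‖v‖ ≤ R

namespace IsBoundedlySupported

variable {n : ℕ} {f g : V0 n → ℂ}

theorem zero : IsBoundedlySupported (0 : V0 n → ℂ) :=
  ⟨measurable_const, ⟨0, by simp⟩, ⟨0, by simp⟩⟩

theorem add (hf : IsBoundedlySupported f) (hg : IsBoundedlySupported g) :
    IsBoundedlySupported (f + g) := by
  obtain ⟨M, hM⟩ := hf.bounded
  obtain ⟨N, hN⟩ := hg.bounded
  obtain ⟨R, hR⟩ := hf.support
  obtain ⟨S, hS⟩ := hg.support
  refine ⟨hf.measurable.add hg.measurable,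
    ⟨M + N, fun v => (norm_add_le _ _).trans (add_le_add (hM v) (hN v))⟩, ⟨max R S, fun v hv => ?_⟩⟩
  by_cases h : f v = 0
  · exact (hS v fun h' => hv (by simp [h, h'])).trans (le_max_right _ _)
  · exact (hR v h).trans (le_max_left _ _)

theorem smul (c : ℂ) (hf : IsBoundedlySupported f) : IsBoundedlySupported (c • f) := by
  obtain ⟨M, hM⟩ := hf.bounded
  obtain ⟨R, hR⟩ := hf.support
  refine ⟨hf.measurable.const_smul c, ⟨‖c‖ * M, fun v => ?_⟩, ⟨R, fun v hv => hR v ?_⟩⟩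
  · rw [Pi.smul_apply, norm_smul]
    exact mul_le_mul_of_nonneg_left (hM v) (norm_nonneg c)
  · exact right_ne_zero_of_mul hv

theorem comp_sub (r : V0 n) (hf : IsBoundedlySupported f) :
    IsBoundedlySupported fun v => f (v - r) := by
  obtain ⟨M, hM⟩ := hf.bounded
  obtain ⟨R, hR⟩ := hf.support
  refine ⟨hf.measurable.comp (measurable_id.sub_const r), ⟨M, fun v => hM _⟩,
    ⟨R + ‖r‖, fun v hv => ?_⟩⟩
  have := hR _ hv
  calc ‖v‖ = ‖(v - r) + r‖ := by rw [sub_add_cancel]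
    _ ≤ ‖v - r‖ + ‖r‖ := norm_add_le _ _
    _ ≤ R + ‖r‖ := by linarith

theorem shiftDiff (r : V0 n) (hf : IsBoundedlySupported f) :
    IsBoundedlySupported (shiftDiff r f) := by
  have : _root_.shiftDiff r f = f + (-1 : ℂ) • fun v => f (v - r) := by
    funext v
    simp [_root_.shiftDiff, sub_eq_add_neg]
  rw [this]
  exact hf.add ((hf.comp_sub r).smul _)

theorem shiftDiffs (s : Multiset (V0 n)) (hf : IsBoundedlySupported f) :
    IsBoundedlySupported (shiftDiffs s f) := by
  induction s using Multiset.induction with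
  | empty => exact hf
  | cons r s ih =>
    rw [shiftDiffs_cons]
    exact ih.shiftDiff r

theorem eq_zero_of_periodic (hf : IsBoundedlySupported f) {w : V0 n} (hw : w ≠ 0)
    (h : ∀ v, f (v + w) = f v) : f = 0 := by
  obtain ⟨R, hR⟩ := hf.support
  have hk : ∀ (k : ℕ) v, f (v + k • w) = f v := by
    intro k
    induction k with
    | zero => simp
    | succ k ih => intro v; rw [succ_nsmul, ← add_assoc, h, ih]
  funext v
  by_contra hv
  -- With this `k` the translate `v + k • w` lies outside the ball of radius `R`, yet `f` takes the
  -- same nonzero value there.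
  obtain ⟨k, hk'⟩ := exists_nat_gt ((R + ‖v‖) / ‖w‖)
  have hw' : 0 < ‖w‖ := norm_pos_iff.mpr hw
  rw [div_lt_iff₀ hw'] at hk'
  have h1 := hR (v + k • w) (by rwa [hk])
  have h2 : ‖k • w‖ = k * ‖w‖ := by rw [← Nat.cast_smul_eq_nsmul ℝ, norm_smul]; simp
  have h3 : ‖k • w‖ ≤ ‖v + k • w‖ + ‖v‖ := by
    calc ‖k • w‖ = ‖(v + k • w) - v‖ := by rw [add_sub_cancel_left]
      _ ≤ _ := norm_sub_le _ _
  linarith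

end IsBoundedlySupported

/-! ### Laplace transforms against translation-invariant measures -/

/-- A measure against which all `e^{-ε|v|}` are integrable and which is invariant under the
translations by the vectors in `s`. -/
structure IsLaplaceMeasure {n : ℕ} (μ : Measure (V0 n)) (s : Multiset (V0 n)) : Prop where
  integrable_exp : ∀ ε : ℝ, 0 < ε → Integrable (fun v : V0 n => Real.exp (-ε * ‖v‖)) μ
  invariant : ∀ r ∈ s, MeasurePreserving (fun v => v - r) μ μ

section

variable {n : ℕ} {μ : Measure (V0 n)} {s : Multiset (V0 n)} {f g : V0 n → ℂ}

theorem IsBoundedlySupported.integrable_mul_expPair (hf : IsBoundedlySupported f)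
    (hμ : IsLaplaceMeasure μ s) (y : Fin n → ℝ) :
    Integrable (fun v => f v * expPair y v) μ := by
  obtain ⟨M, hM⟩ := hf.bounded
  obtain ⟨R, hR⟩ := hf.support
  set K := ∑ i, |y i|
  have hK : 0 ≤ K := Finset.sum_nonneg fun i _ => abs_nonneg _
  -- On the support, `-⟨y, v⟩ ≤ K‖v‖ = (K + 1)‖v‖ - ‖v‖ ≤ (K + 1)R - ‖v‖`.
  refine ((hμ.integrable_exp 1 one_pos).const_mul (M * Real.exp ((K + 1) * R))).mono'
    (hf.measurable.mul (continuous_expPair y).measurable).aestronglyMeasurable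
    (Filter.Eventually.of_forall fun v => ?_)
  have hM0 : 0 ≤ M := (norm_nonneg _).trans (hM v)
  by_cases h : f v = 0
  · simp only [h, zero_mul, norm_zero]
    positivity
  · rw [norm_mul, norm_expPair, mul_assoc, ← Real.exp_add]
    refine mul_le_mul (hM v) (Real.exp_le_exp.mpr ?_) (Real.exp_pos _).le hM0
    have h1 := (abs_le.mp (abs_pairing_le y v)).1
    have h2 := mul_le_mul_of_nonneg_left (hR v h) (by linarith : 0 ≤ K + 1)
    linarith

/-- Substituting `v - r` for `v` turns a translation of `f` into the factor `e^{-⟨y, r⟩}`. -/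
theorem integrable_shiftDiff_mul_expPair (hμ : IsLaplaceMeasure μ s) {r : V0 n} (hr : r ∈ s)
    (y : Fin n → ℝ) (hf : Integrable (fun v => f v * expPair y v) μ) :
    Integrable (fun v => shiftDiff r f v * expPair y v) μ ∧
      ∫ v, shiftDiff r f v * expPair y v ∂μ =
        (1 - expPair y r) * ∫ v, f v * expPair y v ∂μ := by
  have hp := hμ.invariant r hr
  have he : MeasurableEmbedding (fun v : V0 n => v - r) :=
    (MeasurableEquiv.subRight r).measurableEmbedding
  have h1 : Integrable (fun v => expPair y r * (f (v - r) * expPair y (v - r))) μ :=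
    ((hp.integrable_comp_emb he).mpr hf).const_mul _
  have h2 : (fun v => shiftDiff r f v * expPair y v) = fun v =>
      f v * expPair y v - expPair y r * (f (v - r) * expPair y (v - r)) := by
    funext v
    have : expPair y v = expPair y (v - r) * expPair y r := by
      rw [← expPair_add, sub_add_cancel]
    simp only [shiftDiff]
    rw [this]
    ring
  rw [h2]
  refine ⟨hf.sub h1, ?_⟩
  rw [integral_sub hf h1, integral_const_mul,
    hp.integral_comp he (fun v => f v * expPair y v)]
  ring

/-- The Laplace transform `∏ (1 - e^{-⟨y, r⟩})` of the composition of difference operators. -/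
def diffSymbol (s : Multiset (V0 n)) (y : Fin n → ℝ) : ℂ := (s.map fun r => 1 - expPair y r).prod

theorem integrable_shiftDiffs_mul_expPair (hμ : IsLaplaceMeasure μ s) {t : Multiset (V0 n)}
    (ht : t ≤ s) (y : Fin n → ℝ) (hf : Integrable (fun v => f v * expPair y v) μ) :
    Integrable (fun v => shiftDiffs t f v * expPair y v) μ ∧
      ∫ v, shiftDiffs t f v * expPair y v ∂μ = diffSymbol t y * ∫ v, f v * expPair y v ∂μ := by
  induction t using Multiset.induction with
  | empty => simpa [diffSymbol, shiftDiffs_zero] using hf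
  | cons r t ih =>
    obtain ⟨h1, h2⟩ := ih ((Multiset.le_cons_self t r).trans ht)
    obtain ⟨h3, h4⟩ := integrable_shiftDiff_mul_expPair hμ
      (Multiset.mem_of_le ht (Multiset.mem_cons_self r t)) y h1
    rw [shiftDiffs_cons]
    refine ⟨h3, ?_⟩
    rw [h4, h2, diffSymbol, diffSymbol, Multiset.map_cons, Multiset.prod_cons, mul_assoc]

/-- The functions that become boundedly supported under the difference operators of `s`. -/
def tameFunctions (s : Multiset (V0 n)) : Submodule ℂ (V0 n → ℂ) where
  carrier := {f | IsBoundedlySupported (shiftDiffs s f)}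
  add_mem' := by
    intro f g (hf : IsBoundedlySupported _) (hg : IsBoundedlySupported _)
    change IsBoundedlySupported _
    rw [shiftDiffs_add]
    exact hf.add hg
  zero_mem' := by
    change IsBoundedlySupported _
    rw [shiftDiffs_zero_fun]
    exact IsBoundedlySupported.zero
  smul_mem' := by
    intro c f (hf : IsBoundedlySupported _)
    change IsBoundedlySupported _
    rw [shiftDiffs_smul]
    exact hf.smul c

/-- The regularized Laplace transform: the Laplace transform of `shiftDiffs s f`, divided by
`diffSymbol s`. -/
def regLaplace (μ : Measure (V0 n)) (s : Multiset (V0 n)) (f : V0 n → ℂ) (y : Fin n → ℝ) : ℂ :=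
  (diffSymbol s y)⁻¹ * ∫ v, shiftDiffs s f v * expPair y v ∂μ

/-- The regularized Laplace transform as a linear map. -/
def regLaplaceHom (hμ : IsLaplaceMeasure μ s) :
    tameFunctions s →ₗ[ℂ] ((Fin n → ℝ) → ℂ) where
  toFun f := regLaplace μ s f.1
  map_add' := by
    rintro ⟨f, hf : IsBoundedlySupported _⟩ ⟨g, hg : IsBoundedlySupported _⟩
    funext y
    simp only [regLaplace, Submodule.coe_add, shiftDiffs_add, Pi.add_apply, add_mul]
    rw [integral_add (hf.integrable_mul_expPair hμ y) (hg.integrable_mul_expPair hμ y), mul_add]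
  map_smul' := by
    rintro c ⟨f, hf : IsBoundedlySupported _⟩
    funext y
    simp only [regLaplace, Submodule.coe_smul, shiftDiffs_smul, Pi.smul_apply, smul_eq_mul,
      RingHom.id_apply, mul_assoc]
    rw [integral_const_mul]
    ring

theorem regLaplace_eq_zero_of_shiftDiffs (h : shiftDiffs s f = 0) : regLaplace μ s f = 0 := by
  funext y
  simp [regLaplace, h]

/-- Difference operators commute with translations, so the result keeps the period `w` while having
bounded support. -/
theorem shiftDiffs_eq_zero_of_periodic (hf : f ∈ tameFunctions s) {w : V0 n} (hw : w ≠ 0)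
    (h : ∀ v, f (v + w) = f v) : shiftDiffs s f = 0 :=
  IsBoundedlySupported.eq_zero_of_periodic hf hw (shiftDiffs_periodic s h)

theorem mem_tameFunctions_of_le {t : Multiset (V0 n)} (ht : t ≤ s)
    (hf : IsBoundedlySupported (shiftDiffs t f)) : f ∈ tameFunctions s := by
  obtain ⟨u, rfl⟩ := Multiset.le_iff_exists_add.mp ht
  change IsBoundedlySupported _
  rw [add_comm, shiftDiffs_union]
  exact hf.shiftDiffs u

/-- The superfluous operators multiply the integral by their own symbol, which cancels. A cone can
thus be treated with its own rays only, although `s` serves all cones at once. -/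
theorem regLaplace_eq_of_le (hμ : IsLaplaceMeasure μ s) {t : Multiset (V0 n)} (ht : t ≤ s)
    {y : Fin n → ℝ} (hy : diffSymbol s y ≠ 0)
    (hf : Integrable (fun v => shiftDiffs t f v * expPair y v) μ) :
    regLaplace μ s f y = (diffSymbol t y)⁻¹ * ∫ v, shiftDiffs t f v * expPair y v ∂μ := by
  obtain ⟨u, rfl⟩ := Multiset.le_iff_exists_add.mp ht
  have h : diffSymbol (t + u) y = diffSymbol u y * diffSymbol t y := by
    simp [diffSymbol, mul_comm]
  rw [h] at hy
  have h1 := (integrable_shiftDiffs_mul_expPair hμ (Multiset.le_add_left u t) y hf).2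
  rw [regLaplace, h, add_comm t u, shiftDiffs_union, h1]
  field_simp [left_ne_zero_of_mul hy, right_ne_zero_of_mul hy]

theorem regLaplace_eq_integral (hμ : IsLaplaceMeasure μ s) {y : Fin n → ℝ}
    (hy : diffSymbol s y ≠ 0) (hf : Integrable (fun v => f v * expPair y v) μ) :
    regLaplace μ s f y = ∫ v, f v * expPair y v ∂μ := by
  rw [regLaplace_eq_of_le hμ (zero_le : 0 ≤ s) hy hf]
  simp [diffSymbol, shiftDiffs_zero]

/-- Translations preserving `μ` preserve null sets, so differences of a null function stay null. -/
theorem regLaplace_congr_ae (hμ : IsLaplaceMeasure μ s) (h : f =ᵐ[μ] 0) :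
    regLaplace μ s f = 0 := by
  have : ∀ t ≤ s, shiftDiffs t f =ᵐ[μ] 0 := by
    intro t ht
    induction t using Multiset.induction with
    | empty => exact h
    | cons r t ih =>
      have h1 := ih ((Multiset.le_cons_self t r).trans ht)
      have h2 := (hμ.invariant r
        (Multiset.mem_of_le ht (Multiset.mem_cons_self r t))).quasiMeasurePreserving.ae h1
      filter_upwards [h1, h2] with v hv hv'
      simp only [Pi.zero_apply] at hv hv'
      simp [shiftDiffs_cons, shiftDiff, hv, hv']
  funext y
  rw [regLaplace, integral_eq_zero_of_ae, mul_zero, Pi.zero_apply]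
  filter_upwards [this s le_rfl] with v hv
  simp [hv]

end

/-! ### Rational functions with prescribed values -/

theorem algebraMap_fractionRing_ne_zero {A : Type*} [CommRing A] {q : A} (hq : q ≠ 0) :
    algebraMap A (FractionRing A) q ≠ 0 :=
  fun h => hq ((IsFractionRing.injective A (FractionRing A)) (by rw [h, map_zero]))

section

variable {Y A : Type*} [CommRing A] [IsDomain A] [Algebra ℂ A] {ev : Y → A →ₐ[ℂ] ℂ} {d : A}

/-- The fraction `F` takes the values `T y` at all points `y` where `d` does not vanish. -/
def HasValues (ev : Y → A →ₐ[ℂ] ℂ) (d : A) (F : FractionRing A) (T : Y → ℂ) : Prop :=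
  ∃ p q : A, q ≠ 0 ∧ F = algebraMap A (FractionRing A) p / algebraMap A (FractionRing A) q ∧
    ∀ y, ev y d ≠ 0 → ev y q ≠ 0 ∧ ev y p = ev y q * T y

namespace HasValues

variable {F G : FractionRing A} {T U : Y → ℂ}

theorem of_algebraMap (p : A) : HasValues ev d (algebraMap A _ p) fun y => ev y p :=
  ⟨p, 1, one_ne_zero, by simp, fun y _ => by simp⟩

theorem zero : HasValues ev d (0 : FractionRing A) 0 :=
  ⟨0, 1, one_ne_zero, by simp, fun y _ => by simp⟩

theorem one : HasValues ev d (1 : FractionRing A) 1 :=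
  ⟨1, 1, one_ne_zero, by simp, fun y _ => by simp⟩

theorem congr (hF : HasValues ev d F T) (h : ∀ y, ev y d ≠ 0 → U y = T y) :
    HasValues ev d F U := by
  obtain ⟨p, q, hq, rfl, hv⟩ := hF
  exact ⟨p, q, hq, rfl, fun y hy => ⟨(hv y hy).1, by rw [h y hy, (hv y hy).2]⟩⟩

theorem add (hF : HasValues ev d F T) (hG : HasValues ev d G U) :
    HasValues ev d (F + G) (T + U) := by
  obtain ⟨p, q, hq, rfl, hv⟩ := hF
  obtain ⟨p', q', hq', rfl, hv'⟩ := hG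
  refine ⟨p * q' + q * p', q * q', mul_ne_zero hq hq', ?_, fun y hy => ?_⟩
  · rw [div_add_div _ _ (algebraMap_fractionRing_ne_zero hq)
      (algebraMap_fractionRing_ne_zero hq')]
    simp
  · obtain ⟨h1, h2⟩ := hv y hy
    obtain ⟨h3, h4⟩ := hv' y hy
    refine ⟨by rw [map_mul]; exact mul_ne_zero h1 h3, ?_⟩
    simp only [map_add, map_mul, h2, h4, Pi.add_apply]
    ring

theorem mul (hF : HasValues ev d F T) (hG : HasValues ev d G U) :
    HasValues ev d (F * G) (T * U) := by
  obtain ⟨p, q, hq, rfl, hv⟩ := hF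
  obtain ⟨p', q', hq', rfl, hv'⟩ := hG
  refine ⟨p * p', q * q', mul_ne_zero hq hq', by simp [div_mul_div_comm], fun y hy => ?_⟩
  obtain ⟨h1, h2⟩ := hv y hy
  obtain ⟨h3, h4⟩ := hv' y hy
  refine ⟨by rw [map_mul]; exact mul_ne_zero h1 h3, ?_⟩
  simp only [map_mul, h2, h4, Pi.mul_apply]
  ring

theorem smul (c : ℂ) (hF : HasValues ev d F T) : HasValues ev d (c • F) (c • T) := by
  obtain ⟨p, q, hq, rfl, hv⟩ := hF
  refine ⟨c • p, q, hq, ?_, fun y hy => ⟨(hv y hy).1, ?_⟩⟩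
  · rw [Algebra.algebraMap_eq_smul_one (c • p), smul_assoc, ← Algebra.algebraMap_eq_smul_one,
      smul_div_assoc]
  · rw [map_smul, (hv y hy).2, Pi.smul_apply, smul_eq_mul, smul_eq_mul]
    ring

theorem sub (hF : HasValues ev d F T) (hG : HasValues ev d G U) :
    HasValues ev d (F - G) (T - U) := by
  have := hF.add (hG.smul (-1))
  simpa [sub_eq_add_neg] using this

/-- The point in `hd` guarantees a nonzero new denominator: a zero numerator would force `T` to
vanish at that point. -/
theorem inv (hd : ∃ y, ev y d ≠ 0) (hF : HasValues ev d F T) (hT : ∀ y, ev y d ≠ 0 → T y ≠ 0) :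
    HasValues ev d F⁻¹ T⁻¹ := by
  obtain ⟨p, q, hq, rfl, hv⟩ := hF
  refine ⟨q, p, ?_, by rw [inv_div], fun y hy => ?_⟩
  · rintro rfl
    obtain ⟨y, hy⟩ := hd
    have := (hv y hy).2
    rw [map_zero] at this
    exact mul_ne_zero (hv y hy).1 (hT y hy) this.symm
  · obtain ⟨h1, h2⟩ := hv y hy
    refine ⟨by rw [h2]; exact mul_ne_zero h1 (hT y hy), ?_⟩
    rw [h2, Pi.inv_apply, mul_assoc, mul_inv_cancel₀ (hT y hy), mul_one]

theorem prod {κ : Type*} (s : Finset κ) {F : κ → FractionRing A} {T : κ → Y → ℂ}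
    (h : ∀ i ∈ s, HasValues ev d (F i) (T i)) :
    HasValues ev d (∏ i ∈ s, F i) (∏ i ∈ s, T i) := by
  induction s using Finset.cons_induction with
  | empty => simpa using one
  | cons a s ha ih =>
    rw [Finset.prod_cons, Finset.prod_cons]
    exact (h a (Finset.mem_cons_self a s)).mul
      (ih fun i hi => h i (Finset.mem_cons_of_mem hi))

/-- The same coefficients act on both sides, so a linear relation among the `v i` yields a
combination of the `u i` with values zero. -/
theorem linearCombination {ι E : Type*} [AddCommGroup E] [Module ℂ E]
    {u : ι → FractionRing A} {v : ι → E} (T : E →ₗ[ℂ] (Y → ℂ))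
    (h : ∀ i, HasValues ev d (u i) (T (v i))) (c : ι →₀ ℂ) :
    HasValues ev d (Finsupp.linearCombination ℂ u c) (T (Finsupp.linearCombination ℂ v c)) := by
  induction c using Finsupp.induction_linear with
  | zero => simpa using zero
  | add f g hf hg => simpa using hf.add hg
  | single i a => simpa using (h i).smul a

/-- The numerator vanishes wherever `d` does not, so `p * d` vanishes at every point and hence in
the domain `A`. -/
theorem eq_zero (hev : ∀ p, (∀ y, ev y p = 0) → p = 0) (hd : d ≠ 0) (hF : HasValues ev d F 0) :
    F = 0 := by
  obtain ⟨p, q, hq, rfl, hv⟩ := hF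
  have : p * d = 0 := hev _ fun y => by
    rw [map_mul]
    by_cases hy : ev y d = 0
    · rw [hy, mul_zero]
    · rw [(hv y hy).2]
      simp
  rw [(mul_eq_zero.mp this).resolve_right hd]
  simp

/-- Numerator and denominator of `F` can be chosen to vanish where `d` does. -/
theorem exists_eq_mul (hd : d ≠ 0) (hF : HasValues ev d F T) :
    ∃ p q : A, q ≠ 0 ∧ F = algebraMap A (FractionRing A) p / algebraMap A (FractionRing A) q ∧
      ∀ y, (ev y d = 0 → ev y q = 0 ∧ ev y p = 0) ∧ (ev y d ≠ 0 → ev y q * T y = ev y p) := by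
  obtain ⟨p, q, hq, rfl, hv⟩ := hF
  -- The extra factor `d` makes the identity between numerator and denominator trivial at the zeros
  -- of `d`, where `T` carries no information.
  refine ⟨p * d, q * d, mul_ne_zero hq hd, ?_, fun y => ⟨fun hy => by simp [hy], fun hy => ?_⟩⟩
  · rw [map_mul, map_mul, mul_div_mul_right _ _ (algebraMap_fractionRing_ne_zero hd)]
  · rw [map_mul, map_mul, (hv y hy).2]
    ring

end HasValues

/-- A linear map is determined by, and can be prescribed on, a spanning family, as soon as the
prescribed values satisfy the linear relations of the family. -/
theorem existsUnique_linearMap_of_span_eq_top {ι M F : Type*} [AddCommGroup M] [Module ℂ M]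
    [AddCommGroup F] [Module ℂ F] {v : ι → M} {u : ι → F}
    (hv : Submodule.span ℂ (Set.range v) = ⊤)
    (h : ∀ c : ι →₀ ℂ, Finsupp.linearCombination ℂ v c = 0 → Finsupp.linearCombination ℂ u c = 0) :
    ∃! Φ : M →ₗ[ℂ] F, ∀ i, Φ (v i) = u i := by
  have hs : LinearMap.range (Finsupp.linearCombination ℂ v) = ⊤ := by
    rw [Finsupp.range_linearCombination, hv]
  obtain ⟨g, hg⟩ := LinearMap.exists_rightInverse_of_surjective _ hs
  have h0 : ∀ i, ((Finsupp.linearCombination ℂ u).comp g) (v i) = u i := fun i => by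
    have h1 : Finsupp.linearCombination ℂ v (g (v i)) = v i := by
      rw [← LinearMap.comp_apply, hg, LinearMap.id_apply]
    -- `g (v i)` and `single i 1` are two coefficient vectors for `v i`; their difference is a
    -- relation.
    have h2 := h (g (v i) - Finsupp.single i 1) (by simp [h1])
    rw [map_sub, sub_eq_zero] at h2
    simpa using h2
  exact ⟨_, h0, fun Φ hΦ => LinearMap.ext_on hv (by rintro _ ⟨i, rfl⟩; rw [hΦ, h0])⟩

/-- Fractions with prescribed values extend linearly to the quotient by elements on which these
values vanish. -/
theorem exists_quotient_linearMap_hasValues {ι E : Type*} [AddCommGroup E] [Module ℂ E]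
    {N : Submodule ℂ E} {v : ι → E} {u : ι → FractionRing A} (T : E →ₗ[ℂ] (Y → ℂ))
    (hev : ∀ p, (∀ y, ev y p = 0) → p = 0) (hd : d ≠ 0)
    (hv : Submodule.span ℂ (Set.range v) ⊔ N = ⊤) (hN : ∀ f ∈ N, T f = 0)
    (hT : ∀ i, HasValues ev d (u i) (T (v i))) :
    ∃ Φ : (E ⧸ N) →ₗ[ℂ] FractionRing A, (∀ i, Φ (N.mkQ (v i)) = u i) ∧
      (∀ Φ' : (E ⧸ N) →ₗ[ℂ] FractionRing A, (∀ i, Φ' (N.mkQ (v i)) = u i) → Φ' = Φ) ∧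
      ∀ f, HasValues ev d (Φ (N.mkQ f)) (T f) := by
  have hspan : Submodule.span ℂ (Set.range fun i => N.mkQ (v i)) = ⊤ := by
    have : (Set.range fun i => N.mkQ (v i)) = N.mkQ '' Set.range v := by
      rw [← Set.range_comp]; rfl
    rw [this, Submodule.span_image, Submodule.map_mkQ_eq_top, sup_comm, hv]
  have hlc : ∀ c : ι →₀ ℂ, Finsupp.linearCombination ℂ (fun i => N.mkQ (v i)) c =
      N.mkQ (Finsupp.linearCombination ℂ v c) := fun c => by
    rw [Finsupp.apply_linearCombination]; rfl
  -- A relation modulo `N` is a combination lying in `N`, where `T` vanishes; the same combination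
  -- of fractions has values zero, hence is zero.
  obtain ⟨Φ, hΦ, huniq⟩ := existsUnique_linearMap_of_span_eq_top (u := u) hspan fun c hc => by
    rw [hlc, Submodule.mkQ_apply, Submodule.Quotient.mk_eq_zero] at hc
    have := HasValues.linearCombination T hT c
    rw [hN _ hc] at this
    exact this.eq_zero hev hd
  refine ⟨Φ, hΦ, huniq, fun f => ?_⟩
  have hf : f ∈ Submodule.span ℂ (Set.range v) ⊔ N := hv ▸ Submodule.mem_top
  obtain ⟨g, hg, k, hk, rfl⟩ := Submodule.mem_sup.mp hf
  obtain ⟨c, rfl⟩ := Finsupp.mem_span_range_iff_exists_finsupp.mp hg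
  have h1 : N.mkQ k = 0 := by rwa [Submodule.mkQ_apply, Submodule.Quotient.mk_eq_zero]
  have h2 := HasValues.linearCombination T hT c
  rw [map_add, h1, add_zero, map_add, hN k hk, add_zero]
  change HasValues ev d _ (T (Finsupp.linearCombination ℂ v c))
  convert h2 using 1
  change Φ (N.mkQ (Finsupp.linearCombination ℂ v c)) = _
  rw [← hlc, Finsupp.apply_linearCombination]
  exact congrArg (fun w => Finsupp.linearCombination ℂ w c) (funext hΦ)

end

/-! ### Cones cut out by linear inequalities -/

/-- A cone of the hyperplane cut out by an arbitrary set of homogeneous linear inequalities. -/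
def IsInequalityCone {n : ℕ} (C : Set (V0 n)) : Prop :=
  ∃ A : Set (Fin n → ℝ), C = {x | ∀ a ∈ A, 0 ≤ pairing a x}

theorem pairing_comm {n : ℕ} (v w : V0 n) : pairing v.1 w = pairing w.1 v := by
  simp [pairing, mul_comm]

theorem pairing_root {n : ℕ} (y : Fin n → ℝ) (a b : Fin n) : pairing y (root a b) = y a - y b := by
  simp [pairing, root, mul_sub, Finset.sum_sub_distrib, Pi.single_apply]

theorem pairing_ebar {n : ℕ} (I : Finset (Fin n)) (x : V0 n) :
    pairing (ebar I).1 x = ∑ a ∈ I, x.1 a := by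
  have hx : ∑ a, x.1 a = 0 := x.2
  simp [pairing, ebar, sub_mul, Finset.sum_sub_distrib, ← Finset.mul_sum, hx]

theorem pairing_indicator {n : ℕ} (I : Finset (Fin n)) (x : V0 n) :
    pairing (fun a => if a ∈ I then 1 else 0) x = ∑ a ∈ I, x.1 a := by
  simp [pairing]

namespace IsInequalityCone

variable {n : ℕ} {C D : Set (V0 n)}

theorem isClosed (hC : IsInequalityCone C) : IsClosed C := by
  obtain ⟨A, rfl⟩ := hC
  simp only [Set.ofPred_forall]
  exact isClosed_iInter fun a => isClosed_iInter fun _ =>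
    isClosed_le continuous_const (continuous_pairing a)

theorem zero_mem (hC : IsInequalityCone C) : (0 : V0 n) ∈ C := by
  obtain ⟨A, rfl⟩ := hC
  intro a _
  simp [pairing]

theorem smul_mem (hC : IsInequalityCone C) {c : ℝ} (hc : 0 ≤ c) {x : V0 n} (hx : x ∈ C) :
    c • x ∈ C := by
  obtain ⟨A, rfl⟩ := hC
  intro a ha
  rw [pairing_smul_right]
  exact mul_nonneg hc (hx a ha)

theorem convex (hC : IsInequalityCone C) : Convex ℝ C := by
  obtain ⟨A, rfl⟩ := hC
  intro x hx y hy s t hs ht _ a ha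
  rw [pairing_add_right, pairing_smul_right, pairing_smul_right]
  exact add_nonneg (mul_nonneg hs (hx a ha)) (mul_nonneg ht (hy a ha))

theorem inter (hC : IsInequalityCone C) (hD : IsInequalityCone D) : IsInequalityCone (C ∩ D) := by
  obtain ⟨A, rfl⟩ := hC
  obtain ⟨B, rfl⟩ := hD
  refine ⟨A ∪ B, Set.ext fun x => ⟨fun hx a ha => ha.elim (hx.1 a) (hx.2 a), fun hx =>
    ⟨fun a ha => hx a (Or.inl ha), fun a ha => hx a (Or.inr ha)⟩⟩⟩

theorem of_forall {ι : Type*} (a : ι → Fin n → ℝ) :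
    IsInequalityCone {x : V0 n | ∀ i, 0 ≤ pairing (a i) x} :=
  ⟨Set.range a, by ext x; simp⟩

theorem dual (C : Set (V0 n)) : IsInequalityCone (dualConeV0 C) := by
  refine ⟨Subtype.val '' C, Set.ext fun y => ⟨?_, fun hy x hx => ?_⟩⟩
  · rintro hy _ ⟨x, hx, rfl⟩
    rw [pairing_comm]
    exact hy x hx
  · rw [pairing_comm]
    exact hy x.1 ⟨x, hx, rfl⟩

/-- Every defining inequality must be constant along a line contained in the cone, so the direction
of the line is a period. -/
theorem exists_periodic (hC : IsInequalityCone C) (h : ¬ IsPointedCone C) :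
    ∃ w : V0 n, w ≠ 0 ∧ ∀ v, charFn C (v + w) = charFn C v := by
  classical
  obtain ⟨A, rfl⟩ := hC
  simp only [IsPointedCone, not_forall] at h
  obtain ⟨x, w, hxw, hw⟩ := h
  have h0 : ∀ a ∈ A, pairing a w = 0 := by
    intro a ha
    by_contra hne
    -- This parameter makes the inequality `a` take the value `-1` on the line.
    have := hxw (-(pairing a x + 1) / pairing a w) a ha
    rw [pairing_add_right, pairing_smul_right, div_mul_cancel₀ _ hne] at this
    linarith
  refine ⟨w, hw, fun v => ?_⟩
  have : v + w ∈ {x : V0 n | ∀ a ∈ A, 0 ≤ pairing a x} ↔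
      v ∈ {x : V0 n | ∀ a ∈ A, 0 ≤ pairing a x} := by
    refine forall₂_congr fun a ha => ?_
    rw [pairing_add_right, h0 a ha, add_zero]
  simp only [charFn, Set.indicator_apply, this, Pi.one_apply]

/-- `ε` is the minimum of `y` on the compact unit section of the cone, and homogeneity does the
rest. If the section is empty, the cone is `{0}`. -/
theorem exists_norm_le_pairing (hC : IsInequalityCone C) {y : Fin n → ℝ} (hy : y ∈ convDomain C) :
    ∃ ε : ℝ, 0 < ε ∧ ∀ v ∈ C, ε * ‖v‖ ≤ pairing y v := by
  have hK : IsCompact (C ∩ Metric.sphere 0 1) := (isCompact_sphere 0 1).inter_left hC.isClosed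
  rcases (C ∩ Metric.sphere 0 1).eq_empty_or_nonempty with he | hne
  · refine ⟨1, one_pos, fun v hv => ?_⟩
    by_cases h0 : v = 0
    · simp [h0, pairing]
    · have : ‖v‖⁻¹ • v ∈ C ∩ Metric.sphere 0 1 :=
        ⟨hC.smul_mem (by positivity) hv, by
          rw [mem_sphere_zero_iff_norm, norm_smul, norm_inv, norm_norm,
            inv_mul_cancel₀ (norm_ne_zero_iff.mpr h0)]⟩
      rw [he] at this
      exact this.elim
  · obtain ⟨u, hu, hmin⟩ := hK.exists_isMinOn hne (continuous_pairing y).continuousOn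
    have hu0 : u ≠ 0 := by
      rintro rfl
      simpa using hu.2
    refine ⟨pairing y u, hy u hu.1 hu0, fun v hv => ?_⟩
    by_cases h0 : v = 0
    · simp [h0, pairing]
    · have hm : ‖v‖⁻¹ • v ∈ C ∩ Metric.sphere 0 1 :=
        ⟨hC.smul_mem (by positivity) hv, by
          rw [mem_sphere_zero_iff_norm, norm_smul, norm_inv, norm_norm,
            inv_mul_cancel₀ (norm_ne_zero_iff.mpr h0)]⟩
      have h1 : pairing y u ≤ pairing y (‖v‖⁻¹ • v) := hmin hm
      rwa [pairing_smul_right, ← div_eq_inv_mul, le_div_iff₀ (norm_pos_iff.mpr h0)] at h1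

theorem measurable_charFn (hC : IsInequalityCone C) : Measurable (charFn C) :=
  measurable_one.indicator hC.isClosed.measurableSet

theorem integrable_charFn_mul_expPair (hC : IsInequalityCone C) {μ : Measure (V0 n)}
    {s : Multiset (V0 n)} (hμ : IsLaplaceMeasure μ s) {y : Fin n → ℝ} (hy : y ∈ convDomain C) :
    Integrable (fun v => charFn C v * expPair y v) μ := by
  obtain ⟨ε, hε, h⟩ := hC.exists_norm_le_pairing hy
  refine (hμ.integrable_exp ε hε).mono'
    (hC.measurable_charFn.mul (continuous_expPair y).measurable).aestronglyMeasurable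
    (Filter.Eventually.of_forall fun v => ?_)
  by_cases hv : v ∈ C
  · have := h v hv
    simp only [charFn, Set.indicator_of_mem hv, Pi.one_apply, one_mul, norm_expPair]
    exact Real.exp_le_exp.mpr (by linarith)
  · simp only [charFn, Set.indicator_of_notMem hv, zero_mul, norm_zero]
    positivity

end IsInequalityCone

theorem IsPolyhedralCone.isInequalityCone {n : ℕ} {C : Set (V0 n)} (hC : IsPolyhedralCone C) :
    IsInequalityCone C := by
  obtain ⟨m, a, rfl⟩ := hC
  exact IsInequalityCone.of_forall fun i j => (a i j : ℝ)

theorem regLaplace_charFn {n : ℕ} {C : Set (V0 n)} (hC : IsInequalityCone C) {μ : Measure (V0 n)}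
    {s : Multiset (V0 n)} (hμ : IsLaplaceMeasure μ s) {y : Fin n → ℝ} (hy : y ∈ convDomain C)
    (hs : diffSymbol s y ≠ 0) :
    regLaplace μ s (charFn C) y = ∫ v, charFn C v * expPair y v ∂μ :=
  regLaplace_eq_integral hμ hs (hC.integrable_charFn_mul_expPair hμ hy)

theorem regLaplace_charFn_eq_zero {n : ℕ} {C : Set (V0 n)} (hC : IsInequalityCone C)
    (h : ¬ IsPointedCone C) (μ : Measure (V0 n)) {s : Multiset (V0 n)}
    (hf : charFn C ∈ tameFunctions s) : regLaplace μ s (charFn C) = 0 := by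
  obtain ⟨w, hw, hper⟩ := hC.exists_periodic h
  exact regLaplace_eq_zero_of_shiftDiffs (shiftDiffs_eq_zero_of_periodic hf hw hper)

theorem diffSymbol_ne_zero_iff {n : ℕ} {s : Multiset (V0 n)} {y : Fin n → ℝ} :
    diffSymbol s y ≠ 0 ↔ ∀ r ∈ s, pairing y r ≠ 0 := by
  rw [diffSymbol, Ne, Multiset.prod_eq_zero_iff, Multiset.mem_map]
  simp only [not_exists, not_and]
  refine forall₂_congr fun r _ => ?_
  rw [← Ne, sub_ne_zero, ne_comm, Ne, expPair_eq_one_iff]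

/-! ### Simplicial cones -/

/-- Subtracting the translate by `r b` affects only the coordinate `t b`, where it replaces the
indicator of `[0, ∞)` by that of `[0, 1)`. The factor `u`, invariant under all `r b`, plays no role
here. -/
theorem shiftDiffs_orthant {n : ℕ} {κ : Type*} [Fintype κ] [DecidableEq κ] (r : κ → V0 n)
    (t : κ → V0 n → ℝ) (u : V0 n → ℂ)
    (ht : ∀ a b v, t a (v - r b) = t a v - if a = b then 1 else 0)
    (hu : ∀ b v, u (v - r b) = u v) (F : Finset κ) :
    shiftDiffs (F.val.map r) (fun v => u v * ∏ a, if 0 ≤ t a v then 1 else 0) = fun v =>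
      u v * ∏ a, if 0 ≤ t a v ∧ (a ∈ F → t a v < 1) then 1 else 0 := by
  induction F using Finset.cons_induction with
  | empty => simp [shiftDiffs_zero]
  | cons b F hb ih =>
    rw [Finset.cons_val, Multiset.map_cons, shiftDiffs_cons, ih]
    funext v
    have h1 : ∀ a ∈ Finset.univ.erase b, t a (v - r b) = t a v := fun a ha => by
      rw [ht, if_neg (Finset.ne_of_mem_erase ha), sub_zero]
    simp only [shiftDiff, hu]
    rw [← Finset.mul_prod_erase _ _ (Finset.mem_univ b),
      ← Finset.mul_prod_erase _ _ (Finset.mem_univ b),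
      ← Finset.mul_prod_erase _ _ (Finset.mem_univ b), ht, if_pos rfl]
    have h2 : (∏ a ∈ Finset.univ.erase b,
        if 0 ≤ t a (v - r b) ∧ (a ∈ F → t a (v - r b) < 1) then (1 : ℂ) else 0) =
        ∏ a ∈ Finset.univ.erase b, if 0 ≤ t a v ∧ (a ∈ F → t a v < 1) then 1 else 0 :=
      Finset.prod_congr rfl fun a ha => by rw [h1 a ha]
    have h3 : (∏ a ∈ Finset.univ.erase b,
        if 0 ≤ t a v ∧ (a ∈ Finset.cons b F hb → t a v < 1) then (1 : ℂ) else 0) =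
        ∏ a ∈ Finset.univ.erase b, if 0 ≤ t a v ∧ (a ∈ F → t a v < 1) then 1 else 0 :=
      Finset.prod_congr rfl fun a ha => by simp [Finset.ne_of_mem_erase ha]
    rw [h2, h3]
    have h4 : ((if 0 ≤ t b v ∧ (b ∈ Finset.cons b F hb → t b v < 1) then 1 else 0 : ℂ)) =
        (if 0 ≤ t b v ∧ (b ∈ F → t b v < 1) then 1 else 0) -
          if 0 ≤ t b v - 1 ∧ (b ∈ F → t b v - 1 < 1) then 1 else 0 := by
      simp only [hb, Finset.mem_cons, true_or, forall_const, false_imp_iff, and_true]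
      by_cases h5 : 0 ≤ t b v <;> by_cases h6 : t b v < 1
      · simp [h5, h6, not_le.mpr h6]
      · simp [h5, h6, not_lt.mp h6]
      · simp [h5, h6]
      · linarith
    rw [h4]
    ring

/-- The cone `∑ t_a r_a`, `t_a ≥ 0`, given by its coordinate functions on the vectors where `u`
does not vanish. -/
structure IsSimplicialCone {n : ℕ} {κ : Type*} [DecidableEq κ] [Fintype κ] (C : Set (V0 n))
    (r : κ → V0 n) (t : κ → V0 n → ℝ) (u : V0 n → ℂ) : Prop where
  charFn_eq : ∀ v, charFn C v = u v * ∏ a, if 0 ≤ t a v then 1 else 0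
  measurable_coord : ∀ a, Measurable (t a)
  coord_sub : ∀ a b v, t a (v - r b) = t a v - if a = b then 1 else 0
  measurable_u : Measurable u
  u_sub : ∀ b v, u (v - r b) = u v
  u_le : ∀ v, ‖u v‖ ≤ 1
  eq_sum : ∀ v, u v ≠ 0 → v = ∑ a, t a v • r a

namespace IsSimplicialCone

variable {n : ℕ} {κ : Type*} [DecidableEq κ] [Fintype κ] {C : Set (V0 n)}
  {r : κ → V0 n} {t : κ → V0 n → ℝ} {u : V0 n → ℂ}

theorem shiftDiffs_charFn (h : IsSimplicialCone C r t u) :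
    shiftDiffs (Finset.univ.val.map r) (charFn C) = fun v =>
      u v * ∏ a, if 0 ≤ t a v ∧ t a v < 1 then 1 else 0 := by
  have h1 := shiftDiffs_orthant r t u h.coord_sub h.u_sub Finset.univ
  rw [← funext h.charFn_eq] at h1
  simpa using h1

theorem coord_mem_of_ne_zero (h : IsSimplicialCone C r t u) {v : V0 n}
    (hv : shiftDiffs (Finset.univ.val.map r) (charFn C) v ≠ 0) :
    u v ≠ 0 ∧ ∀ a, 0 ≤ t a v ∧ t a v < 1 := by
  rw [h.shiftDiffs_charFn] at hv
  refine ⟨left_ne_zero_of_mul hv, fun a => ?_⟩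
  have := Finset.prod_ne_zero_iff.mp (right_ne_zero_of_mul hv) a (Finset.mem_univ a)
  by_contra hn
  exact this (if_neg hn)

/-- The differences leave the indicator of a half-open parallelepiped, whose points have norm at
most `∑ ‖r a‖`. -/
theorem isBoundedlySupported (h : IsSimplicialCone C r t u) :
    IsBoundedlySupported (shiftDiffs (Finset.univ.val.map r) (charFn C)) := by
  refine ⟨?_, ⟨1, fun v => ?_⟩, ⟨∑ a, ‖r a‖, fun v hv => ?_⟩⟩
  · rw [h.shiftDiffs_charFn]
    refine h.measurable_u.mul (Finset.measurable_prod _ fun a _ => ?_)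
    refine Measurable.ite ?_ measurable_const measurable_const
    exact (measurableSet_le measurable_const (h.measurable_coord a)).inter
      (measurableSet_lt (h.measurable_coord a) measurable_const)
  · rw [h.shiftDiffs_charFn, norm_mul, norm_prod]
    refine mul_le_one₀ (h.u_le v) (Finset.prod_nonneg fun a _ => norm_nonneg _)
      (Finset.prod_le_one (fun a _ => norm_nonneg _) fun a _ => ?_)
    split_ifs <;> simp
  · obtain ⟨h1, h2⟩ := h.coord_mem_of_ne_zero hv
    rw [h.eq_sum v h1]
    refine (norm_sum_le _ _).trans (Finset.sum_le_sum fun a _ => ?_)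
    rw [norm_smul, Real.norm_of_nonneg (h2 a).1]
    exact mul_le_of_le_one_left (norm_nonneg _) (h2 a).2.le

end IsSimplicialCone

/-- The pairing with `y` as a linear map. -/
def pairingHom {n : ℕ} (y : Fin n → ℝ) : V0 n →ₗ[ℝ] ℝ where
  toFun := pairing y
  map_add' := pairing_add_right y
  map_smul' := pairing_smul_right y

theorem pairing_sum_right {n : ℕ} {κ : Type*} (s : Finset κ) (y : Fin n → ℝ) (t : κ → ℝ)
    (r : κ → V0 n) : pairing y (∑ a ∈ s, t a • r a) = ∑ a ∈ s, t a * pairing y (r a) := by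
  have := map_sum (pairingHom y) (fun a => t a • r a) s
  simp only [map_smul, smul_eq_mul] at this
  exact this

theorem eq_zero_of_apply_eq {n : ℕ} {v : V0 n} (h : ∀ a b, v.1 a = v.1 b) : v = 0 := by
  refine Subtype.ext (funext fun a => ?_)
  have hv : ∑ b, v.1 b = 0 := v.2
  rw [Finset.sum_congr rfl fun b _ => h b a] at hv
  have : (n : ℝ) ≠ 0 := by
    have := a.pos
    positivity
  simpa [this] using hv

/-! ### Plates -/

namespace OrderedSetPartition

variable {n : ℕ} (S : OrderedSetPartition n)

/-- The position of the block that contains `a`. -/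
def index (a : Fin n) : Fin S.len := (S.cover a).choose

theorem mem_block_iff {a : Fin n} {i : Fin S.len} : a ∈ S.block i ↔ S.index a = i := by
  have h := (S.cover a).choose_spec
  constructor
  · intro ha
    by_contra hne
    exact Finset.disjoint_left.mp (S.disjoint _ _ hne) h ha
  · rintro rfl
    exact h

theorem mem_head_iff {a : Fin n} {j : ℕ} : a ∈ S.head j ↔ (S.index a : ℕ) < j := by
  simp only [head, Finset.mem_biUnion, Finset.mem_filter, Finset.mem_univ, true_and,
    mem_block_iff]
  exact ⟨fun ⟨i, hi, h⟩ => h ▸ hi, fun h => ⟨_, h, rfl⟩⟩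

theorem index_surjective : Function.Surjective S.index := fun i => by
  obtain ⟨a, ha⟩ := S.nonempty i
  exact ⟨a, S.mem_block_iff.mp ha⟩

theorem mem_plate_iff {x : V0 n} :
    x ∈ S.plate ↔ ∀ k : Fin (S.len - 1), 0 ≤ ∑ a ∈ S.head (k + 1), x.1 a := by
  refine ⟨fun h k => h _ (Finset.mem_Ico.mpr ⟨by omega, by omega⟩), fun h j hj => ?_⟩
  obtain ⟨h1, h2⟩ := Finset.mem_Ico.mp hj
  have := h ⟨j - 1, by omega⟩
  simpa only [Nat.sub_add_cancel h1] using this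

theorem isInequalityCone_plate : IsInequalityCone S.plate := by
  have : S.plate = {x : V0 n | ∀ k : Fin (S.len - 1),
      0 ≤ pairing (fun a => if a ∈ S.head (k + 1) then 1 else 0) x} := by
    ext x
    simp only [mem_plate_iff, pairing_indicator]
    rfl
  rw [this]
  exact IsInequalityCone.of_forall _

theorem sum_head_root (j : ℕ) (a b : Fin n) :
    ∑ c ∈ S.head j, (root a b).1 c =
      (if (S.index a : ℕ) < j then 1 else 0) - if (S.index b : ℕ) < j then 1 else 0 := by
  rw [← pairing_indicator, pairing_root]
  simp only [mem_head_iff]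

theorem root_mem_plate {a b : Fin n} (h : S.index a ≤ S.index b) : root a b ∈ S.plate := by
  intro j _
  rw [sum_head_root]
  have h' : (S.index a : ℕ) ≤ S.index b := h
  split_ifs <;> first | omega | norm_num

theorem index_ofPerm (σ : Equiv.Perm (Fin n)) (a : Fin n) :
    ((ofPerm σ).index a : ℕ) = σ.symm a := by
  have h : a ∈ (ofPerm σ).block (σ.symm a) := by
    change a ∈ {σ (σ.symm a)}
    simp
  exact congrArg Fin.val ((ofPerm σ).mem_block_iff.mp h)

theorem mem_head_ofPerm (σ : Equiv.Perm (Fin n)) {i : Fin n} {j : ℕ} :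
    σ i ∈ (ofPerm σ).head j ↔ (i : ℕ) < j := by
  rw [mem_head_iff, index_ofPerm, Equiv.symm_apply_apply]

theorem exists_ofPerm_plate_eq (h : Function.Injective S.index) :
    ∃ σ : Equiv.Perm (Fin n), (ofPerm σ).plate = S.plate := by
  let e : Fin n ≃ Fin S.len := Equiv.ofBijective S.index ⟨h, S.index_surjective⟩
  have hn : n = S.len := by simpa using Fintype.card_congr e
  let σ : Equiv.Perm (Fin n) := ((finCongr hn).trans e.symm)
  have hσ : ∀ j, (ofPerm σ).head j = S.head j := by
    intro j
    ext a
    rw [mem_head_iff, mem_head_iff, index_ofPerm]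
    rfl
  refine ⟨σ, ?_⟩
  ext x
  simp only [plate, hσ, ← hn]
  rfl

/-- The consecutive roots `e_{σ_k} - e_{σ_{k+1}}`. -/
def permRoot (σ : Equiv.Perm (Fin n)) (k : Fin (n - 1)) : V0 n :=
  root (σ ⟨k, by omega⟩) (σ ⟨k + 1, by omega⟩)

/-- The partial sums of the coordinates in the order given by `σ`. -/
def permCoord (σ : Equiv.Perm (Fin n)) (k : Fin (n - 1)) (v : V0 n) : ℝ :=
  ∑ a ∈ (ofPerm σ).head (k + 1), v.1 a

theorem permCoord_eq_pairing (σ : Equiv.Perm (Fin n)) (k : Fin (n - 1)) (v : V0 n) :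
    permCoord σ k v = pairing (fun a => if a ∈ (ofPerm σ).head (k + 1) then 1 else 0) v :=
  (pairing_indicator _ _).symm

theorem permCoord_permRoot (σ : Equiv.Perm (Fin n)) (k l : Fin (n - 1)) :
    permCoord σ k (permRoot σ l) = if k = l then 1 else 0 := by
  rw [permCoord, permRoot, sum_head_root, index_ofPerm, index_ofPerm, Equiv.symm_apply_apply,
    Equiv.symm_apply_apply]
  simp only [Fin.ext_iff]
  split_ifs <;> first | omega | norm_num

/-- Coordinates are differences of consecutive partial sums; the missing full sum vanishes on the
hyperplane. -/
theorem eq_zero_of_permCoord (σ : Equiv.Perm (Fin n)) {v : V0 n}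
    (h : ∀ k, permCoord σ k v = 0) : v = 0 := by
  have hs : ∀ j, j ≤ n → ∑ a ∈ (ofPerm σ).head j, v.1 a = 0 := by
    intro j hj
    rcases Nat.eq_zero_or_pos j with rfl | hj0
    · simp [head]
    rcases hj.lt_or_eq with hj' | rfl
    · have := h ⟨j - 1, by omega⟩
      simpa only [permCoord, Nat.sub_add_cancel hj0] using this
    · have : (ofPerm σ).head j = Finset.univ := by
        ext a
        simp only [mem_head_iff, Finset.mem_univ, iff_true]
        exact ((ofPerm σ).index a).2
      rw [this]
      exact v.2
  refine Subtype.ext (funext fun a => ?_)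
  obtain ⟨i, rfl⟩ := σ.surjective a
  have h1 : (ofPerm σ).head (i + 1) = insert (σ i) ((ofPerm σ).head i) := by
    ext b
    obtain ⟨l, rfl⟩ := σ.surjective b
    simp only [mem_head_ofPerm, Finset.mem_insert, σ.injective.eq_iff, Fin.ext_iff]
    omega
  have h2 := hs (i + 1) i.2
  rw [h1, Finset.sum_insert (by simp [mem_head_ofPerm]), hs i i.2.le, add_zero] at h2
  exact h2

theorem eq_sum_permRoot (σ : Equiv.Perm (Fin n)) (v : V0 n) :
    v = ∑ k, permCoord σ k v • permRoot σ k := by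
  rw [← sub_eq_zero]
  refine eq_zero_of_permCoord σ fun k => ?_
  rw [permCoord_eq_pairing, pairing_sub_right, pairing_sum_right]
  simp only [← permCoord_eq_pairing, permCoord_permRoot]
  simp

/-- The partial sums defining the plate form the basis dual to the consecutive roots. The cone is
full-dimensional, so `u = 1`. -/
theorem isSimplicialCone_plate (σ : Equiv.Perm (Fin n)) :
    IsSimplicialCone (ofPerm σ).plate (permRoot σ) (permCoord σ) 1 where
  charFn_eq v := by
    classical
    rw [Pi.one_apply, one_mul, charFn, Set.indicator_apply, Finset.prod_ite_zero]
    simp only [mem_plate_iff, permCoord, Finset.mem_univ, forall_const, Finset.prod_const_one,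
      Pi.one_apply]
    rfl
  measurable_coord k := by
    rw [funext (permCoord_eq_pairing σ k)]
    exact (continuous_pairing _).measurable
  coord_sub k l v := by
    rw [permCoord_eq_pairing, pairing_sub_right, ← permCoord_eq_pairing, ← permCoord_eq_pairing,
      permCoord_permRoot]
  measurable_u := measurable_one
  u_sub _ _ := rfl
  u_le _ := by simp
  eq_sum v _ := eq_sum_permRoot σ v

/-! ### Dual plates -/

/-- A label in the block at position `i`. -/
def rep (i : Fin S.len) : Fin n := (S.nonempty i).choose

theorem index_rep (i : Fin S.len) : S.index (S.rep i) = i :=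
  S.mem_block_iff.mp (S.nonempty i).choose_spec

/-- The coordinate of `v` on the block at position `i`. -/
def blockValue (i : ℕ) (v : V0 n) : ℝ := if h : i < S.len then v.1 (S.rep ⟨i, h⟩) else 0

/-- The ray generators `ē_{S_1 ∪ ⋯ ∪ S_k}` of the dual of a plate. -/
def dualRay (k : Fin (S.len - 1)) : V0 n := ebar (S.head (k + 1))

/-- The coordinates with respect to the ray generators of the dual of a plate. -/
def dualCoord (k : Fin (S.len - 1)) (v : V0 n) : ℝ := S.blockValue k v - S.blockValue (k + 1) v

/-- The vectors that are constant on the blocks. -/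
def blockConstant : Set (V0 n) := {v | ∀ a b, S.index a = S.index b → v.1 a = v.1 b}

theorem blockValue_index {v : V0 n} (hv : v ∈ S.blockConstant) (a : Fin n) :
    S.blockValue (S.index a) v = v.1 a := by
  rw [blockValue, dif_pos (S.index a).2]
  exact hv _ _ (S.index_rep _)

theorem measurable_dualCoord (k : Fin (S.len - 1)) : Measurable (S.dualCoord k) := by
  have h : ∀ i, Measurable (S.blockValue i) := by
    intro i
    unfold blockValue
    split_ifs
    · exact (measurable_pi_apply _).comp measurable_subtype_coe
    · exact measurable_const
  exact (h _).sub (h _)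

theorem dualCoord_sub (k l : Fin (S.len - 1)) (v : V0 n) :
    S.dualCoord k (v - S.dualRay l) = S.dualCoord k v - if k = l then 1 else 0 := by
  -- Since `k < S.len - 1`, positions `k` and `k + 1` are both genuine blocks, and the default value
  -- of `blockValue` does not occur.
  have h1 : (k : ℕ) < S.len := by omega
  have h2 : (k : ℕ) + 1 < S.len := by omega
  have h3 : ((if (k : ℕ) < l + 1 then 1 else 0 : ℝ) - if (k : ℕ) + 1 < l + 1 then 1 else 0) =
      if k = l then 1 else 0 := by
    simp only [Fin.ext_iff]
    split_ifs <;> first | omega | norm_num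
  rw [← h3]
  simp only [dualCoord, blockValue, dif_pos h1, dif_pos h2, dualRay, ebar, mem_head_iff,
    AddSubgroupClass.coe_sub, Pi.sub_apply, index_rep]
  ring

theorem dualRay_mem_blockConstant (k : Fin (S.len - 1)) : S.dualRay k ∈ S.blockConstant := by
  intro a b hab
  simp [dualRay, ebar, mem_head_iff, hab]

theorem sub_dualRay_mem_iff (k : Fin (S.len - 1)) (v : V0 n) :
    v - S.dualRay k ∈ S.blockConstant ↔ v ∈ S.blockConstant := by
  refine forall₃_congr fun a b hab => ?_
  have := S.dualRay_mem_blockConstant k a b hab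
  simp [this]

/-- Only the terms with `k ≥ i` survive, and they telescope. -/
theorem sum_range_sub_ite (w : ℕ → ℝ) (i m : ℕ) :
    (∑ k ∈ Finset.range m, if i < k + 1 then w k - w (k + 1) else 0) =
      if i ≤ m then w i - w m else 0 := by
  induction m with
  | zero => by_cases h : i = 0 <;> simp [h]
  | succ m ih =>
    rw [Finset.sum_range_succ, ih]
    rcases lt_trichotomy i (m + 1) with h | rfl | h
    · rw [if_pos (by omega), if_pos h, if_pos h.le]
      ring
    · simp
    · rw [if_neg (by omega), if_neg (by omega), if_neg (by omega), add_zero]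

/-- Abel summation over the blocks recovers each coordinate up to a constant independent of the
label, and the hyperplane contains no nonzero constant vector. -/
theorem eq_sum_dualRay {v : V0 n} (hv : v ∈ S.blockConstant) :
    v = ∑ k, S.dualCoord k v • S.dualRay k := by
  have h : ∀ a, (∑ k, S.dualCoord k v • S.dualRay k).1 a =
      v.1 a - S.blockValue (S.len - 1) v -
        ∑ k : Fin (S.len - 1), S.dualCoord k v * (((S.head (k + 1)).card : ℝ) / n) := by
    intro a
    have h1 : v.1 a - S.blockValue (S.len - 1) v =
        ∑ k : Fin (S.len - 1), if (S.index a : ℕ) < k + 1 then S.dualCoord k v else 0 := by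
      simp only [dualCoord]
      rw [Fin.sum_univ_eq_sum_range (fun k => if (S.index a : ℕ) < k + 1 then
          S.blockValue k v - S.blockValue (k + 1) v else 0),
        sum_range_sub_ite (fun k => S.blockValue k v), if_pos (by omega), S.blockValue_index hv]
    rw [h1, ← Finset.sum_sub_distrib]
    simp [dualRay, ebar, mem_head_iff, mul_sub]
  rw [← sub_eq_zero]
  refine eq_zero_of_apply_eq fun a b => ?_
  simp only [AddSubgroupClass.coe_sub, Pi.sub_apply, h]
  ring

/-- The plate contains `e_a - e_b` whenever the block of `a` is not after that of `b`, so a dual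
vector is constant on blocks and decreases weakly along them. Conversely, such a vector is a
nonnegative combination of the `ē` of the heads, whose pairings with the plate are the defining
inequalities. -/
theorem mem_dual_plate_iff {v : V0 n} :
    v ∈ dualConeV0 S.plate ↔ v ∈ S.blockConstant ∧ ∀ k, 0 ≤ S.dualCoord k v := by
  constructor
  · intro hv
    have h1 : ∀ a b, S.index a ≤ S.index b → v.1 b ≤ v.1 a := fun a b hab => by
      have := hv _ (S.root_mem_plate hab)
      rw [pairing_root] at this
      linarith
    refine ⟨fun a b hab => le_antisymm (h1 b a hab.ge) (h1 a b hab.le), fun k => ?_⟩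
    rw [dualCoord, blockValue, blockValue, dif_pos (by omega), dif_pos (by omega), sub_nonneg]
    apply h1
    rw [index_rep, index_rep, Fin.mk_le_mk]
    omega
  · rintro ⟨h1, h2⟩ x hx
    rw [S.eq_sum_dualRay h1, pairing_comm, pairing_sum_right]
    refine Finset.sum_nonneg fun k _ => mul_nonneg (h2 k) ?_
    rw [pairing_comm, dualRay, pairing_ebar]
    exact S.mem_plate_iff.mp hx k

theorem measurableSet_blockConstant : MeasurableSet S.blockConstant := by
  unfold blockConstant
  simp only [Set.ofPred_forall]
  refine MeasurableSet.iInter fun a => MeasurableSet.iInter fun b => MeasurableSet.iInter fun _ => ?_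
  exact measurableSet_eq_fun ((measurable_pi_apply a).comp measurable_subtype_coe)
    ((measurable_pi_apply b).comp measurable_subtype_coe)

/-- The rays span only the block-constant vectors, a proper subspace if some block has two labels;
the indicator of that subspace serves as `u`. -/
theorem isSimplicialCone_dual_plate :
    IsSimplicialCone (dualConeV0 S.plate) S.dualRay S.dualCoord
      (S.blockConstant.indicator 1) where
  charFn_eq v := by
    classical
    rw [charFn, Set.indicator_apply, Set.indicator_apply, Finset.prod_ite_zero]
    simp only [mem_dual_plate_iff, Finset.mem_univ, forall_const, Finset.prod_const_one,
      Pi.one_apply, ite_and]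
    split_ifs <;> simp
  measurable_coord := S.measurable_dualCoord
  coord_sub := S.dualCoord_sub
  measurable_u := measurable_one.indicator S.measurableSet_blockConstant
  u_sub k v := by
    classical
    simp only [Set.indicator_apply, sub_dualRay_mem_iff, Pi.one_apply]
  u_le v := by
    classical
    rw [Set.indicator_apply]
    split_ifs <;> simp
  eq_sum v hv := S.eq_sum_dualRay (Set.mem_of_indicator_ne_zero hv)

theorem dualRay_ne (k : Fin (S.len - 1)) : S.head (k + 1) ≠ ∅ ∧ S.head (k + 1) ≠ Finset.univ := by
  constructor
  · refine Finset.nonempty_iff_ne_empty.mp ⟨S.rep ⟨k, by omega⟩, ?_⟩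
    rw [mem_head_iff, index_rep]
    exact Nat.lt_succ_self _
  · intro h
    have : S.rep ⟨k + 1, by omega⟩ ∈ S.head (k + 1) := by rw [h]; exact Finset.mem_univ _
    rw [mem_head_iff, index_rep] at this
    exact lt_irrefl _ this

theorem head_injective : Function.Injective fun k : Fin (S.len - 1) => S.head (k + 1) := by
  intro k l h
  have h1 : ∀ i : Fin S.len, (i : ℕ) < k + 1 ↔ (i : ℕ) < l + 1 := fun i => by
    have := Finset.ext_iff.mp h (S.rep i)
    rwa [mem_head_iff, mem_head_iff, index_rep] at this
  have h2 := h1 ⟨k, by omega⟩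
  have h3 := h1 ⟨l, by omega⟩
  ext
  simp only at h2 h3
  omega

end OrderedSetPartition

/-! ### The measures -/

/-- Reduces exponential decay to polynomial decay of exponent one above a given dimension, for which
integrals and lattice sums converge. -/
theorem exp_neg_mul_le_rpow {ε : ℝ} (hε : 0 < ε) (k : ℕ) :
    ∃ M : ℝ, ∀ x : ℝ, 0 ≤ x → Real.exp (-ε * x) ≤ M * (1 + x) ^ (-((k + 1 : ℕ) : ℝ)) := by
  set m : ℝ := ((k + 1 : ℕ) : ℝ) with hm
  have hm0 : 0 < m := by positivity
  -- From `e^z ≥ 1 + z` at `z = εx/m`: the bound `K ≥ 1` takes care of the summand `1`, and `K ≥ m /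
  -- ε` of `x`. The estimate is then raised to the power `m`.
  set K : ℝ := max 1 (m / ε) with hK
  have hK1 : 1 ≤ K := le_max_left _ _
  refine ⟨K ^ (k + 1), fun x hx => ?_⟩
  have h1 : 1 + x ≤ K * Real.exp (ε * x / m) := by
    have h2 : ε * x / m + 1 ≤ Real.exp (ε * x / m) := Real.add_one_le_exp _
    have h3 : x ≤ K * (ε * x / m) := by
      calc x = m / ε * (ε * x / m) := by field_simp
        _ ≤ K * (ε * x / m) := mul_le_mul_of_nonneg_right (le_max_right _ _) (by positivity)
    nlinarith
  have h4 : (1 + x) ^ (k + 1) ≤ K ^ (k + 1) * Real.exp (ε * x) := by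
    calc (1 + x) ^ (k + 1) ≤ (K * Real.exp (ε * x / m)) ^ (k + 1) :=
          pow_le_pow_left₀ (by positivity) h1 _
      _ = K ^ (k + 1) * Real.exp (ε * x) := by
          rw [mul_pow, ← Real.exp_nat_mul, ← hm, mul_div_cancel₀ _ hm0.ne']
  rw [Real.rpow_neg (by positivity), hm, Real.rpow_natCast, ← div_eq_mul_inv,
    le_div_iff₀ (by positivity), neg_mul, Real.exp_neg, inv_mul_le_iff₀ (Real.exp_pos _), mul_comm]
  exact h4

namespace OrderedSetPartition

variable {n : ℕ}

/-- The coordinates with respect to the consecutive roots in the order given by `σ`. -/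
def permEquiv (σ : Equiv.Perm (Fin n)) : (Fin (n - 1) → ℝ) ≃ₗ[ℝ] V0 n where
  toFun t := ∑ k, t k • permRoot σ k
  invFun v k := permCoord σ k v
  map_add' s t := by simp [add_smul, Finset.sum_add_distrib]
  map_smul' c t := by simp [Finset.smul_sum, mul_smul]
  left_inv t := by
    funext k
    change permCoord σ k (∑ l, t l • permRoot σ l) = t k
    rw [permCoord_eq_pairing, pairing_sum_right]
    simp only [← permCoord_eq_pairing, permCoord_permRoot]
    simp
  right_inv v := (eq_sum_permRoot σ v).symm

theorem norm_permEquiv (σ : Equiv.Perm (Fin n)) (t : Fin (n - 1) → ℝ) :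
    ‖permEquiv σ t‖ = ‖permEquiv 1 t‖ := by
  have h : ∀ i, (permEquiv σ t).1 (σ i) = (permEquiv 1 t).1 i := by
    intro i
    simp [permEquiv, permRoot, root, Pi.single_apply]
  change ‖(permEquiv σ t).1‖ = ‖(permEquiv 1 t).1‖
  refine le_antisymm ((pi_norm_le_iff_of_nonneg (norm_nonneg _)).mpr fun a => ?_)
    ((pi_norm_le_iff_of_nonneg (norm_nonneg _)).mpr fun i => ?_)
  · obtain ⟨i, rfl⟩ := σ.surjective a
    rw [h]
    exact norm_le_pi_norm _ i
  · rw [← h]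
    exact norm_le_pi_norm _ _

theorem rootVolume_eq_map :
    rootVolume n = Measure.map (permEquiv 1).toContinuousLinearEquiv volume := rfl

instance instIsAddHaarMeasureRootVolume : (rootVolume n).IsAddHaarMeasure := by
  rw [rootVolume_eq_map]
  exact ContinuousLinearEquiv.isAddHaarMeasure_map _ _

/-- Both sides are Haar measures, so they differ by a scalar. The scalar is `1` because permuting
coordinates preserves the sup norm, so the unit ball has the same preimage under both
parametrizations. -/
theorem map_permEquiv (σ : Equiv.Perm (Fin n)) :
    Measure.map (permEquiv σ).toContinuousLinearEquiv volume = rootVolume n := by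
  set ν := Measure.map (permEquiv σ).toContinuousLinearEquiv (volume : Measure (Fin (n - 1) → ℝ))
    with hν
  have : ν.IsAddHaarMeasure := ContinuousLinearEquiv.isAddHaarMeasure_map _ _
  have h1 : ν = Measure.addHaarScalarFactor ν (rootVolume n) • rootVolume n :=
    Measure.isAddLeftInvariant_eq_smul _ _
  set c := Measure.addHaarScalarFactor ν (rootVolume n)
  have hB : MeasurableSet (Metric.closedBall (0 : V0 n) 1) := measurableSet_closedBall
  have h2 : ν (Metric.closedBall 0 1) = rootVolume n (Metric.closedBall 0 1) := by
    rw [hν, rootVolume_eq_map,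
      Measure.map_apply (permEquiv σ).toContinuousLinearEquiv.continuous.measurable hB,
      Measure.map_apply (permEquiv 1).toContinuousLinearEquiv.continuous.measurable hB]
    congr 1
    ext t
    simp [norm_permEquiv σ]
  have h3 : rootVolume n (Metric.closedBall 0 1) ≠ 0 :=
    (Metric.measure_closedBall_pos _ _ one_pos).ne'
  have h4 : rootVolume n (Metric.closedBall 0 1) ≠ ⊤ := measure_closedBall_lt_top.ne
  have hc : (c : ENNReal) = 1 := by
    rw [h1, Measure.smul_apply] at h2
    rw [← ENNReal.mul_left_inj h3 h4, one_mul]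
    exact h2
  rw [h1, show c = 1 from by exact_mod_cast hc, one_smul]

theorem isLaplaceMeasure_rootVolume (s : Multiset (V0 n)) :
    IsLaplaceMeasure (rootVolume n) s where
  integrable_exp ε hε := by
    obtain ⟨M, hM⟩ := exp_neg_mul_le_rpow hε (Module.finrank ℝ (V0 n))
    have h1 : Integrable (fun v : V0 n =>
        (1 + ‖v‖) ^ (-((Module.finrank ℝ (V0 n) + 1 : ℕ) : ℝ))) (rootVolume n) :=
      integrable_one_add_norm (by push_cast; linarith)
    refine (h1.const_mul M).mono' (by fun_prop) (Filter.Eventually.of_forall fun v => ?_)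
    rw [Real.norm_of_nonneg (Real.exp_pos _).le]
    exact hM _ (norm_nonneg _)
  invariant r _ := measurePreserving_sub_right _ r

end OrderedSetPartition

/-! ### Counting measures of lattices -/

/-- The counting measure of a subgroup. -/
def latticeMeasure {n : ℕ} (Λ : AddSubgroup (V0 n)) : Measure (V0 n) :=
  Measure.sum fun v : Λ => Measure.dirac v.1

theorem measurePreserving_latticeMeasure {n : ℕ} {Λ : AddSubgroup (V0 n)} {r : V0 n} (hr : r ∈ Λ) :
    MeasurePreserving (fun v => v - r) (latticeMeasure Λ) (latticeMeasure Λ) := by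
  have hm : Measurable fun v : V0 n => v - r := measurable_id.sub_const r
  refine ⟨hm, Measure.ext fun B hB => ?_⟩
  rw [Measure.map_apply hm hB, latticeMeasure, Measure.sum_apply _ hB,
    Measure.sum_apply _ (hm hB)]
  refine Eq.trans (tsum_congr fun v => ?_)
    ((Equiv.subRight (⟨r, hr⟩ : Λ)).tsum_eq fun v => Measure.dirac v.1 B)
  rw [Measure.dirac_apply' _ hB, Measure.dirac_apply' _ (hm hB)]
  rfl

/-- `n v_a = ∑_b (v_a - v_b)`, because the coordinates sum to zero. -/
theorem exists_int_mul_of_mem_weightLattice {n : ℕ} {v : V0 n} (hv : v ∈ weightLattice n)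
    (a : Fin n) : ∃ m : ℤ, (n : ℝ) * v.1 a = m := by
  choose m hm using hv a
  refine ⟨∑ b, m b, ?_⟩
  have h0 : ∑ b, v.1 b = 0 := v.2
  push_cast
  simp only [← hm, Finset.sum_sub_distrib, h0]
  simp

/-- Scaling by `n` embeds the weight lattice into `ℤ^n`, where sums of negative powers of the norm
are known to converge. -/
theorem summable_exp_weightLattice {n : ℕ} (hn : 1 ≤ n) {ε : ℝ} (hε : 0 < ε) :
    Summable fun v : weightLattice n => Real.exp (-ε * ‖v.1‖) := by
  classical
  have hn0 : (0 : ℝ) < n := by exact_mod_cast hn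
  set L := Submodule.span ℤ (Set.range (Pi.basisFun ℝ (Fin n)))
  have hL : ∀ δ : ℝ, 0 < δ → Summable fun z : L => Real.exp (-δ * ‖z‖) := by
    intro δ hδ
    obtain ⟨M, hM⟩ := exp_neg_mul_le_rpow hδ (Module.finrank ℤ L)
    have h1 : Summable fun z : L => ‖z‖ ^ (-((Module.finrank ℤ L + 1 : ℕ) : ℝ)) :=
      ZLattice.summable_norm_rpow L _ (by push_cast; linarith)
    have hM0 : 0 ≤ M := by
      have := hM 0 le_rfl
      simp only [mul_zero, Real.exp_zero, add_zero, Real.one_rpow, mul_one] at this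
      linarith
    -- The power of `‖z‖` gives no bound at `z = 0`; the added unit mass there dominates `e^0 = 1`.
    refine Summable.of_nonneg_of_le (fun z => (Real.exp_pos _).le) (fun z => ?_)
      ((h1.mul_left M).add (hasSum_ite_eq (0 : L) (1 : ℝ)).summable)
    by_cases hz : z = 0
    · have : 0 ≤ M * ‖z‖ ^ (-((Module.finrank ℤ L + 1 : ℕ) : ℝ)) := by positivity
      simp only [hz, if_true, norm_zero, mul_zero, Real.exp_zero] at this ⊢
      linarith
    · rw [if_neg hz, add_zero]
      refine (hM _ (norm_nonneg _)).trans (mul_le_mul_of_nonneg_left ?_ hM0)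
      refine Real.rpow_le_rpow_of_nonpos (norm_pos_iff.mpr hz) (by linarith) ?_
      rw [Left.neg_nonpos_iff]
      positivity
  have hmem : ∀ v : weightLattice n, (n : ℝ) • v.1.1 ∈ L := by
    intro v
    rw [Module.Basis.mem_span_iff_repr_mem ℤ]
    intro a
    obtain ⟨m, hm⟩ := exists_int_mul_of_mem_weightLattice v.2 a
    exact ⟨m, by simp [hm]⟩
  have hinj : Function.Injective fun v : weightLattice n => (⟨(n : ℝ) • v.1.1, hmem v⟩ : L) := by
    intro v w h
    exact Subtype.ext (Subtype.ext (smul_right_injective _ hn0.ne' (congrArg Subtype.val h)))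
  refine ((hL (ε / n) (by positivity)).comp_injective hinj).congr fun v => ?_
  change Real.exp (-(ε / n) * ‖(n : ℝ) • v.1.1‖) = Real.exp (-ε * ‖v.1.1‖)
  rw [norm_smul, Real.norm_of_nonneg hn0.le]
  congr 1
  field_simp

theorem isLaplaceMeasure_latticeMeasure {n : ℕ} (hn : 1 ≤ n) {Λ : AddSubgroup (V0 n)}
    (hΛ : Λ ≤ weightLattice n) {s : Multiset (V0 n)} (hs : ∀ r ∈ s, r ∈ Λ) :
    IsLaplaceMeasure (latticeMeasure Λ) s where
  integrable_exp ε hε := by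
    have h1 : ∀ ε : ℝ, 0 < ε → Summable fun v : Λ => Real.exp (-ε * ‖v.1‖) := fun ε hε => by
      have hi : Function.Injective fun v : Λ => (⟨v.1, hΛ v.2⟩ : weightLattice n) :=
        fun v w h => Subtype.ext (by simpa using h)
      simpa only [Function.comp_def] using (summable_exp_weightLattice hn hε).comp_injective hi
    -- A summable family of positive numbers has a countable index set.
    have : Countable Λ := by
      have h2 := (h1 1 one_pos).countable_support
      rw [Function.support_eq_univ fun v => (Real.exp_pos _).ne'] at h2
      exact Set.countable_univ_iff.mp h2
    refine integrable_sum_measure (fun v => integrable_dirac (by simp)) ?_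
    simpa using h1 ε hε
  invariant r hr := measurePreserving_latticeMeasure (hs r hr)

theorem hasSum_latticeMeasure {n : ℕ} {Λ : AddSubgroup (V0 n)} {f : V0 n → ℂ}
    (hf : Integrable f (latticeMeasure Λ)) :
    HasSum (fun v : Λ => f v.1) (∫ v, f v ∂latticeMeasure Λ) := by
  have h := hasSum_integral_measure hf
  simp only [integral_dirac] at h
  exact h

theorem rootLattice_le_weightLattice (n : ℕ) : rootLattice n ≤ weightLattice n := by
  intro v hv a b
  obtain ⟨k, hk⟩ := hv a
  obtain ⟨l, hl⟩ := hv b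
  exact ⟨k - l, by rw [hk, hl]; push_cast; rfl⟩

/-! ### The Euler characteristic and duality of cones -/

section Euler

open Classical in
/-- A linear relation between the characteristic functions of compact intervals forces the sum of
the coefficients of the nonempty ones to vanish. -/
theorem sum_nonempty_interval_eq_zero {ι : Type*} (F : Finset ι) (c : ι → ℂ) (I : ι → Set ℝ)
    (hc : ∀ i, IsCompact (I i)) (hI : ∀ i, (I i).OrdConnected)
    (h : ∀ t, ∑ i ∈ F, (if t ∈ I i then c i else 0) = 0) :
    ∑ i ∈ F, (if (I i).Nonempty then c i else 0) = 0 := by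
  rw [← Finset.sum_filter]
  set G := F.filter fun i => (I i).Nonempty with hG
  have hne : ∀ i ∈ G, (I i).Nonempty := fun i hi => (Finset.mem_filter.mp hi).2
  let a : ι → ℝ := fun i => sInf (I i)
  let b : ι → ℝ := fun i => sSup (I i)
  have hmem : ∀ i ∈ G, ∀ t, t ∈ I i ↔ a i ≤ t ∧ t ≤ b i := fun i hi t =>
    ⟨fun ht => ⟨csInf_le (hc i).bddBelow ht, le_csSup (hc i).bddAbove ht⟩, fun ht =>
      (hI i).out ((hc i).sInf_mem (hne i hi)) ((hc i).sSup_mem (hne i hi)) ht⟩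
  have hab : ∀ i ∈ G, a i ≤ b i := fun i hi =>
    ((hmem i hi (a i)).mp ((hc i).sInf_mem (hne i hi))).2
  have hG0 : ∀ t, ∑ i ∈ G, (if a i ≤ t ∧ t ≤ b i then c i else 0) = 0 := fun t => by
    rw [hG, Finset.sum_filter]
    refine Eq.trans (Finset.sum_congr rfl fun i hi => ?_) (h t)
    by_cases hn : (I i).Nonempty
    · simp only [hn, if_true, hmem i (Finset.mem_filter.mpr ⟨hi, hn⟩) t]
    · rw [if_neg hn, if_neg fun ht => hn ⟨t, ht⟩]
  -- The intervals ending exactly at `t` have coefficients summing to zero: subtract the relation at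
  -- a point `t'` just right of `t`, before any endpoint larger than `t`. Only these intervals are
  -- lost in between.
  have hfib : ∀ t, ∑ i ∈ G with b i = t, c i = 0 := by
    intro t
    obtain ⟨t', ht', hgap⟩ : ∃ t' > t, ∀ i ∈ G, (t < a i → t' < a i) ∧ (t < b i → t' < b i) := by
      have hev : ∀ᶠ t' in nhdsWithin t (Set.Ioi t), ∀ i ∈ G,
          (t < a i → t' < a i) ∧ (t < b i → t' < b i) := by
        have hx : ∀ x : ℝ, ∀ᶠ t' in nhdsWithin t (Set.Ioi t), t < x → t' < x := fun x => by
          by_cases hlt : t < x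
          · filter_upwards [nhdsWithin_le_nhds (Iio_mem_nhds hlt)] with t' ht' _ using ht'
          · exact Filter.Eventually.of_forall fun _ h => absurd h hlt
        rw [Filter.eventually_all_finset]
        exact fun i _ => (hx _).and (hx _)
      obtain ⟨t', h1, h2⟩ := (hev.and self_mem_nhdsWithin).exists
      exact ⟨t', h2, h1⟩
    have := congrArg₂ (· - ·) (hG0 t) (hG0 t')
    simp only [← Finset.sum_sub_distrib, sub_zero] at this
    rw [← this, Finset.sum_filter]
    refine Finset.sum_congr rfl fun i hi => ?_
    obtain ⟨h1, h2⟩ := hgap i hi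
    have h3 := hab i hi
    by_cases hb : b i = t
    · rw [if_pos hb, if_pos ⟨by linarith, hb.ge⟩, if_neg fun h => by linarith [h.2], sub_zero]
    · have : (a i ≤ t ∧ t ≤ b i) ↔ (a i ≤ t' ∧ t' ≤ b i) := by
        constructor
        · rintro ⟨h4, h5⟩
          exact ⟨by linarith, (h2 (lt_of_le_of_ne h5 (Ne.symm hb))).le⟩
        · rintro ⟨h4, h5⟩
          exact ⟨not_lt.mp fun h => by linarith [h1 h], by linarith⟩
      rw [if_neg hb]
      simp only [this, sub_self]
  rw [← Finset.sum_fiberwise_of_maps_to (t := G.image b) fun i hi => Finset.mem_image_of_mem b hi]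
  exact Finset.sum_eq_zero fun t _ => hfib t

open Classical in
/-- A linear relation between the characteristic functions of compact convex sets forces the sum
of the coefficients of the nonempty ones to vanish. -/
theorem sum_nonempty_convex_eq_zero {ι : Type*} {n : ℕ} (F : Finset ι) (c : ι → ℂ)
    (K : ι → Set (Fin n → ℝ)) (hK : ∀ i, IsCompact (K i)) (hconv : ∀ i, Convex ℝ (K i))
    (h : ∀ x, ∑ i ∈ F, (if x ∈ K i then c i else 0) = 0) :
    ∑ i ∈ F, (if (K i).Nonempty then c i else 0) = 0 := by
  -- Induction on the number `m` of free coordinates, the remaining ones being fixed to those of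
  -- `p`. For `m = 0` the slice is a point and the claim is the hypothesis; for `m = n` it is the
  -- conclusion.
  have key : ∀ m : ℕ, ∀ p : Fin n → ℝ,
      ∑ i ∈ F, (if (K i ∩ {x | ∀ j : Fin n, m ≤ j → x j = p j}).Nonempty then c i else 0) = 0 := by
    intro m
    induction m with
    | zero =>
      intro p
      refine Eq.trans (Finset.sum_congr rfl fun i _ => ?_) (h p)
      have : (K i ∩ {x | ∀ j : Fin n, 0 ≤ (j : ℕ) → x j = p j}).Nonempty ↔ p ∈ K i := by
        constructor
        · rintro ⟨x, hx, hp⟩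
          rwa [← show x = p from funext fun j => hp j (Nat.zero_le _)]
        · exact fun hp => ⟨p, hp, fun _ _ => rfl⟩
      simp only [this]
    | succ m ih =>
      intro p
      by_cases hm : m < n
      · let A : Set (Fin n → ℝ) := {x | ∀ j : Fin n, m + 1 ≤ (j : ℕ) → x j = p j}
        have hAcl : IsClosed A := by
          simp only [A, Set.ofPred_forall]
          exact isClosed_iInter fun j => isClosed_iInter fun _ =>
            isClosed_eq (continuous_apply j) continuous_const
        have hAconv : Convex ℝ A := by
          intro x hx y hy s t _ _ hst j hj
          simp only [Pi.add_apply, Pi.smul_apply, smul_eq_mul, hx j hj, hy j hj]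
          rw [← add_mul, hst, one_mul]
        -- The slice with one more free coordinate is projected to that coordinate. The image is a
        -- compact interval, and the induction hypothesis on the fibres is the relation needed for
        -- the one-dimensional case.
        let I : ι → Set ℝ := fun i => (fun x : Fin n → ℝ => x ⟨m, hm⟩) '' (K i ∩ A)
        have hI := sum_nonempty_interval_eq_zero F c I
          (fun i => ((hK i).inter_right hAcl).image (continuous_apply _))
          (fun i => (((hconv i).inter hAconv).linear_image
            (LinearMap.proj (⟨m, hm⟩ : Fin n) : (Fin n → ℝ) →ₗ[ℝ] ℝ)).ordConnected)
          (fun t => by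
            refine Eq.trans (Finset.sum_congr rfl fun i _ => ?_) (ih (Function.update p ⟨m, hm⟩ t))
            have : t ∈ I i ↔ (K i ∩ {x | ∀ j : Fin n, m ≤ (j : ℕ) →
                x j = Function.update p ⟨m, hm⟩ t j}).Nonempty := by
              constructor
              · rintro ⟨x, ⟨hx, hxA⟩, rfl⟩
                refine ⟨x, hx, fun j hj => ?_⟩
                by_cases hjm : j = ⟨m, hm⟩
                · subst hjm
                  simp
                · rw [Function.update_of_ne hjm]
                  have : (j : ℕ) ≠ m := fun h => hjm (Fin.ext h)
                  exact hxA j (by omega)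
              · rintro ⟨x, hx, hxp⟩
                refine ⟨x, ⟨hx, fun j hj => ?_⟩, ?_⟩
                · rw [hxp j (by omega), Function.update_of_ne]
                  rintro rfl
                  simp at hj
                · simpa using hxp ⟨m, hm⟩ le_rfl
            simp only [this])
        simpa only [I, Set.image_nonempty] using hI
      · refine Eq.trans (Finset.sum_congr rfl fun i _ => ?_) (ih p)
        have : {x : Fin n → ℝ | ∀ j : Fin n, m + 1 ≤ (j : ℕ) → x j = p j} =
            {x | ∀ j : Fin n, m ≤ (j : ℕ) → x j = p j} := by
          ext x
          refine forall_congr' fun j => ?_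
          have h1 : ¬ m + 1 ≤ (j : ℕ) := by omega
          have h2 : ¬ m ≤ (j : ℕ) := by omega
          simp only [h1, h2]
        rw [this]
  refine Eq.trans (Finset.sum_congr rfl fun i _ => ?_) (key n 0)
  have : {x : Fin n → ℝ | ∀ j : Fin n, n ≤ (j : ℕ) → x j = (0 : Fin n → ℝ) j} = Set.univ :=
    Set.eq_univ_of_forall fun x j hj => absurd j.2 (by omega)
  rw [this, Set.inter_univ]

end Euler

variable {n : ℕ}

/-- A linear relation between characteristic functions of cones also holds for the dual cones. -/
theorem sum_charFn_dual_eq_zero {ι : Type*} (F : Finset ι) (c : ι → ℂ) (C : ι → Set (V0 n))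
    (hC : ∀ i, IsInequalityCone (C i)) (h : ∀ x, ∑ i ∈ F, c i * charFn (C i) x = 0) (w : V0 n) :
    ∑ i ∈ F, c i * charFn (dualConeV0 (C i)) w = 0 := by
  classical
  -- A point of `C i` at which `w` is negative, rescaled so that the pairing is `-1`.
  have hex : ∀ i, ∃ x : V0 n, w ∉ dualConeV0 (C i) → x ∈ C i ∧ pairing w.1 x ≤ -1 := by
    intro i
    by_cases hw : w ∈ dualConeV0 (C i)
    · exact ⟨0, fun h => absurd hw h⟩
    · have hw' : ∃ x ∈ C i, pairing w.1 x < 0 := by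
        by_contra hcon
        push Not at hcon
        exact hw hcon
      obtain ⟨x, hx, hneg⟩ := hw'
      refine ⟨(-pairing w.1 x)⁻¹ • x, fun _ => ⟨(hC i).smul_mem (by
        rw [inv_nonneg]; linarith) hx, ?_⟩⟩
      rw [pairing_smul_right, inv_neg, neg_mul, inv_mul_cancel₀ hneg.ne]
  choose x hx using hex
  -- A ball of this radius contains all the witnesses `x i`, so the truncation to a compact set
  -- loses no nonemptiness.
  set R : ℝ := ∑ i ∈ F, ‖x i‖
  let B : Set (V0 n) := {z | pairing w.1 z ≤ -1} ∩ Metric.closedBall 0 R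
  have hB : IsCompact B := (isCompact_closedBall 0 R).inter_left
    (isClosed_le (continuous_pairing _) continuous_const)
  have hBconv : Convex ℝ B := by
    refine Convex.inter (fun a ha b hb s t hs ht hst => ?_) (convex_closedBall 0 R)
    have ha' : pairing w.1 a ≤ -1 := ha
    have hb' : pairing w.1 b ≤ -1 := hb
    change pairing w.1 (s • a + t • b) ≤ -1
    rw [pairing_add_right, pairing_smul_right, pairing_smul_right]
    nlinarith
  let K : ι → Set (Fin n → ℝ) := fun i => (V0 n).subtype '' (C i ∩ B)
  have h1 := sum_nonempty_convex_eq_zero F c K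
    (fun i => (hB.inter_left (hC i).isClosed).image continuous_subtype_val)
    (fun i => ((hC i).convex.inter hBconv).linear_image _)
    (fun z => by
      by_cases hz : ∃ u ∈ B, u.1 = z
      · obtain ⟨u, hu, rfl⟩ := hz
        refine Eq.trans (Finset.sum_congr rfl fun i _ => ?_) (h u)
        have : u.1 ∈ K i ↔ u ∈ C i := by
          constructor
          · rintro ⟨u', hu', heq⟩
            rw [← Subtype.ext heq]
            exact hu'.1
          · exact fun hu' => ⟨u, ⟨hu', hu⟩, rfl⟩
        simp [charFn, Set.indicator_apply, this]
      · refine Finset.sum_eq_zero fun i _ => if_neg ?_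
        rintro ⟨u, hu, rfl⟩
        exact hz ⟨u, hu.2, rfl⟩)
  -- Every cone contains the origin, so this is the given relation at `0`.
  have h2 : ∑ i ∈ F, c i = 0 := by
    refine Eq.trans (Finset.sum_congr rfl fun i _ => ?_) (h 0)
    simp [charFn, Set.indicator_of_mem (hC i).zero_mem]
  have h3 : ∀ i ∈ F, c i * charFn (dualConeV0 (C i)) w =
      c i - if (K i).Nonempty then c i else 0 := by
    intro i hi
    by_cases hw : w ∈ dualConeV0 (C i)
    · have hempty : ¬ (K i).Nonempty := by
        rintro ⟨_, u, ⟨hu, hu', -⟩, rfl⟩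
        have h4 := hw u hu
        have h5 : pairing w.1 u ≤ -1 := hu'
        linarith
      simp [charFn, Set.indicator_of_mem hw, hempty]
    · have hne : (K i).Nonempty := by
        obtain ⟨h4, h5⟩ := hx i hw
        refine ⟨_, x i, ⟨h4, h5, ?_⟩, rfl⟩
        rw [mem_closedBall_zero_iff]
        exact Finset.single_le_sum (f := fun i => ‖x i‖) (fun i _ => norm_nonneg _) hi
      simp [charFn, Set.indicator_of_notMem hw, hne]
  rw [Finset.sum_congr rfl h3, Finset.sum_sub_distrib, h1, h2, sub_zero]

/-! ### Duality as a linear map -/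

/-- The span of the characteristic functions of all inequality cones. -/
def coneSpan (n : ℕ) : Submodule ℂ (V0 n → ℂ) :=
  Submodule.span ℂ (Set.range fun C : {C : Set (V0 n) // IsInequalityCone C} => charFn C.1)

/-- The characteristic function of an inequality cone, as an element of the span. -/
def coneFn (C : {C : Set (V0 n) // IsInequalityCone C}) : coneSpan n :=
  ⟨charFn C.1, Submodule.subset_span ⟨C, rfl⟩⟩

theorem span_range_codRestrict_eq_top {ι E : Type*} [AddCommGroup E] [Module ℂ E] (f : ι → E) :
    Submodule.span ℂ (Set.range fun i =>
      (⟨f i, Submodule.subset_span ⟨i, rfl⟩⟩ : Submodule.span ℂ (Set.range f))) = ⊤ := by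
  rw [← Submodule.span_span_coe_preimage (R := ℂ) (s := Set.range f)]
  congr 1
  ext x
  constructor
  · rintro ⟨i, rfl⟩
    exact ⟨i, rfl⟩
  · rintro ⟨i, hi⟩
    exact ⟨i, Subtype.ext hi⟩

/-- Duality of cones extends to a linear map. -/
theorem exists_dualMap (n : ℕ) : ∃ D : coneSpan n →ₗ[ℂ] (V0 n → ℂ),
    ∀ C, D (coneFn C) = charFn (dualConeV0 C.1) := by
  refine (existsUnique_linearMap_of_span_eq_top (v := coneFn (n := n))
    (span_range_codRestrict_eq_top _) fun c hc => ?_).exists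
  funext w
  have h := sum_charFn_dual_eq_zero c.support c (fun C => C.1) (fun C => C.2) (fun x => by
    have h0 : Finsupp.linearCombination ℂ (coneFn (n := n)) c = 0 := hc
    have := congrFun (congrArg (coneSpan n).subtype h0) x
    rw [Finsupp.apply_linearCombination, Finsupp.linearCombination_apply, Finsupp.sum] at this
    simpa [coneFn] using this) w
  simpa [Finsupp.linearCombination_apply, Finsupp.sum] using h

/-- The linear extension of `[C] ↦ [C⋆]`. -/
def dualMap (n : ℕ) : coneSpan n →ₗ[ℂ] (V0 n → ℂ) := (exists_dualMap n).choose

theorem dualMap_coneFn (C : {C : Set (V0 n) // IsInequalityCone C}) :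
    dualMap n (coneFn C) = charFn (dualConeV0 C.1) := (exists_dualMap n).choose_spec C

/-! ### Laplace transforms of simplicial cones -/

/-- Integral coordinates in `[0, 1)` vanish, so the origin is the only lattice point of the
half-open parallelepiped; the numerator is `1` and only the symbol of the rays remains. -/
theorem IsSimplicialCone.regLaplace_latticeMeasure {n : ℕ} {κ : Type*} [DecidableEq κ] [Fintype κ]
    {C : Set (V0 n)} {r : κ → V0 n} {t : κ → V0 n → ℝ} {u : V0 n → ℂ}
    (h : IsSimplicialCone C r t u) {Λ : AddSubgroup (V0 n)} {s : Multiset (V0 n)}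
    (hμ : IsLaplaceMeasure (latticeMeasure Λ) s) (hs : Finset.univ.val.map r ≤ s)
    (ht : ∀ v ∈ Λ, ∀ a, ∃ m : ℤ, t a v = m) (hu : u 0 = 1) (ht0 : ∀ a, t a 0 = 0)
    {y : Fin n → ℝ} (hy : diffSymbol s y ≠ 0) :
    regLaplace (latticeMeasure Λ) s (charFn C) y = ∏ a, (1 - expPair y (r a))⁻¹ := by
  have hint := h.isBoundedlySupported.integrable_mul_expPair hμ y
  rw [regLaplace_eq_of_le hμ hs hy hint]
  have h1 : ∀ v : Λ, v ≠ 0 →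
      shiftDiffs (Finset.univ.val.map r) (charFn C) v.1 * expPair y v.1 = 0 := by
    intro v hv
    by_contra hne
    obtain ⟨hu', hc⟩ := h.coord_mem_of_ne_zero (left_ne_zero_of_mul hne)
    refine hv (Subtype.ext ?_)
    rw [h.eq_sum v.1 hu']
    refine Finset.sum_eq_zero fun a _ => ?_
    obtain ⟨m, hm⟩ := ht v.1 v.2 a
    have h2 := hc a
    rw [hm] at h2
    have h3 : 0 ≤ m := by exact_mod_cast h2.1
    have h4 : m < 1 := by exact_mod_cast h2.2
    rw [hm, show m = 0 by omega, Int.cast_zero, zero_smul]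
  have h2 : shiftDiffs (Finset.univ.val.map r) (charFn C) 0 * expPair y 0 = 1 := by
    rw [h.shiftDiffs_charFn, (expPair_eq_one_iff y 0).mpr (by simp [pairing])]
    simp [hu, ht0]
  have h3 := (hasSum_latticeMeasure hint).unique (hasSum_single (0 : Λ) h1)
  rw [h3, ZeroMemClass.coe_zero, h2, mul_one, diffSymbol, Multiset.map_map, Finset.prod_inv_distrib]
  rfl

theorem integral_Ico_cexp {c : ℝ} (hc : c ≠ 0) :
    ∫ t : ℝ, (if 0 ≤ t ∧ t < 1 then 1 else 0) * Complex.exp (-((t * c : ℝ) : ℂ)) =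
      (1 - Complex.exp (-(c : ℂ))) * (c : ℂ)⁻¹ := by
  have hc' : -(c : ℂ) ≠ 0 := by simpa using hc
  have h1 : (fun t : ℝ => (if 0 ≤ t ∧ t < 1 then 1 else 0) * Complex.exp (-((t * c : ℝ) : ℂ))) =
      (Set.Ico (0 : ℝ) 1).indicator fun t : ℝ => Complex.exp (-(c : ℂ) * t) := by
    funext t
    rw [Set.indicator_apply]
    simp only [Set.mem_Ico]
    split_ifs
    · rw [one_mul]
      congr 1
      push_cast
      ring
    · rw [zero_mul]
  rw [h1, integral_indicator measurableSet_Ico, integral_Ico_eq_integral_Ioc,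
    ← intervalIntegral.integral_of_le zero_le_one, integral_exp_mul_complex hc']
  have : (c : ℂ) ≠ 0 := by exact_mod_cast hc
  field_simp
  simp

namespace OrderedSetPartition

/-- In the coordinates of `permEquiv σ` the parallelepiped is the unit cube, and the integral
factors into terms `(1 - e^{-c}) / c`; their numerators cancel against the symbol. -/
theorem regLaplace_rootVolume (σ : Equiv.Perm (Fin n)) {s : Multiset (V0 n)}
    (hs : Finset.univ.val.map (permRoot σ) ≤ s) {y : Fin n → ℝ} (hy : diffSymbol s y ≠ 0) :
    regLaplace (rootVolume n) s (charFn (ofPerm σ).plate) y =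
      ∏ k, (pairing y (permRoot σ k) : ℂ)⁻¹ := by
  have hμ := isLaplaceMeasure_rootVolume (n := n) s
  have h := isSimplicialCone_plate σ
  have hne : ∀ k, pairing y (permRoot σ k) ≠ 0 := fun k => diffSymbol_ne_zero_iff.mp hy _
    (Multiset.mem_of_le hs (Multiset.mem_map_of_mem _ (Finset.mem_univ k)))
  rw [regLaplace_eq_of_le hμ hs hy (h.isBoundedlySupported.integrable_mul_expPair hμ y)]
  have h1 : ∫ v, shiftDiffs (Finset.univ.val.map (permRoot σ)) (charFn (ofPerm σ).plate) v *
      expPair y v ∂rootVolume n =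
      ∏ k, ((1 - expPair y (permRoot σ k)) * (pairing y (permRoot σ k) : ℂ)⁻¹) := by
    have he : MeasurableEmbedding (permEquiv σ).toContinuousLinearEquiv :=
      (permEquiv σ).toContinuousLinearEquiv.toHomeomorph.measurableEmbedding
    rw [h.shiftDiffs_charFn, ← map_permEquiv σ, he.integral_map]
    simp only [expPair, ← integral_Ico_cexp (hne _)]
    rw [← integral_fintype_prod_volume_eq_prod]
    congr 1
    funext t
    have h2 : ∀ k, permCoord σ k (permEquiv σ t) = t k :=
      fun k => congrFun ((permEquiv σ).left_inv t) k
    have h3 : pairing y (permEquiv σ t) = ∑ k, t k * pairing y (permRoot σ k) :=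
      pairing_sum_right _ _ _ _
    change ((1 : V0 n → ℂ) (permEquiv σ t) * ∏ k, if 0 ≤ permCoord σ k (permEquiv σ t) ∧
      permCoord σ k (permEquiv σ t) < 1 then (1 : ℂ) else 0) *
        Complex.exp (-(pairing y (permEquiv σ t) : ℂ)) = _
    rw [Finset.prod_mul_distrib, ← Complex.exp_sum, h3]
    simp only [h2, Pi.one_apply, one_mul]
    congr 2
    push_cast
    rw [Finset.sum_neg_distrib]
  rw [h1, Finset.prod_mul_distrib, ← mul_assoc, diffSymbol, Multiset.map_map]
  have h4 : (Finset.univ.val.map ((fun r => 1 - expPair y r) ∘ permRoot σ)).prod =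
      ∏ k, (1 - expPair y (permRoot σ k)) := rfl
  rw [h4, inv_mul_cancel₀, one_mul]
  refine Finset.prod_ne_zero_iff.mpr fun k _ => ?_
  rw [sub_ne_zero, ne_comm, Ne, expPair_eq_one_iff]
  exact hne k

theorem exists_int_permCoord (σ : Equiv.Perm (Fin n)) {v : V0 n} (hv : v ∈ rootLattice n)
    (k : Fin (n - 1)) : ∃ m : ℤ, permCoord σ k v = m := by
  choose m hm using hv
  exact ⟨∑ a ∈ (ofPerm σ).head (k + 1), m a, by simp [permCoord, hm]⟩

theorem exists_int_dualCoord (S : OrderedSetPartition n) {v : V0 n} (hv : v ∈ weightLattice n)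
    (k : Fin (S.len - 1)) : ∃ m : ℤ, S.dualCoord k v = m := by
  rw [dualCoord, blockValue, blockValue, dif_pos (by omega), dif_pos (by omega)]
  exact hv _ _

end OrderedSetPartition

open OrderedSetPartition

/-! ### The regularized Laplace transforms on the span of the plates -/

/-- The pairs of distinct labels. -/
def distinctPairs (n : ℕ) : Finset (Fin n × Fin n) := {p | p.1 ≠ p.2}

/-- The roots. -/
def allRoots (n : ℕ) : Multiset (V0 n) := (distinctPairs n).val.map fun p => root p.1 p.2

theorem root_mem_allRoots {a b : Fin n} (h : a ≠ b) : root a b ∈ allRoots n :=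
  Multiset.mem_map.mpr ⟨(a, b), by simpa [distinctPairs] using h, rfl⟩

theorem forall_mem_allRoots {p : V0 n → Prop} :
    (∀ r ∈ allRoots n, p r) ↔ ∀ a b, a ≠ b → p (root a b) := by
  refine ⟨fun h a b hab => h _ (root_mem_allRoots hab), fun h r hr => ?_⟩
  obtain ⟨⟨a, b⟩, hab, rfl⟩ := Multiset.mem_map.mp hr
  exact h a b (by simpa [distinctPairs] using hab)

/-- This is an inclusion with multiplicities; it holds because different positions give different
pairs of labels. -/
theorem map_permRoot_le_allRoots (σ : Equiv.Perm (Fin n)) :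
    Finset.univ.val.map (permRoot σ) ≤ allRoots n := by
  let e : Fin (n - 1) ↪ Fin n × Fin n :=
    ⟨fun k => (σ ⟨k, by omega⟩, σ ⟨k + 1, by omega⟩), fun k l h => by
      have := congrArg Prod.fst h
      simpa [Fin.ext_iff] using this⟩
  have h1 : Finset.univ.val.map (permRoot σ) =
      (Finset.univ.map e).val.map fun p => root p.1 p.2 := by
    rw [Finset.map_val, Multiset.map_map]
    rfl
  rw [h1]
  refine Multiset.map_le_map (Finset.val_le_iff.mpr fun p hp => ?_)
  obtain ⟨k, -, rfl⟩ := Finset.mem_map.mp hp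
  rw [distinctPairs, Finset.mem_filter]
  refine ⟨Finset.mem_univ _, fun h => ?_⟩
  have := congrArg Fin.val (σ.injective h)
  simp at this

theorem root_mem_rootLattice (a b : Fin n) : root a b ∈ rootLattice n := fun c =>
  ⟨(if c = a then 1 else 0) - if c = b then 1 else 0, by simp [root, Pi.single_apply]⟩

theorem root_ne_zero {a b : Fin n} (h : a ≠ b) : root a b ≠ 0 := by
  intro h0
  have := congrFun (congrArg Subtype.val h0) a
  simp [root, h] at this

/-- No head separates two labels of the same block, so the partial sums do not see `e_a - e_b`. -/
theorem OrderedSetPartition.charFn_plate_sub_root (S : OrderedSetPartition n) {a b : Fin n}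
    (h : S.index a = S.index b) (v : V0 n) :
    charFn S.plate (v - root a b) = charFn S.plate v := by
  classical
  have : v - root a b ∈ S.plate ↔ v ∈ S.plate := by
    refine forall₂_congr fun j _ => ?_
    simp only [AddSubgroupClass.coe_sub, Pi.sub_apply, Finset.sum_sub_distrib, sum_head_root, h,
      sub_self, sub_zero]
  simp only [charFn, Set.indicator_apply, this, Pi.one_apply]

theorem OrderedSetPartition.not_isPointedCone_plate (S : OrderedSetPartition n) {a b : Fin n}
    (hab : a ≠ b) (h : S.index a = S.index b) : ¬ IsPointedCone S.plate := by
  intro hp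
  refine root_ne_zero hab (hp 0 _ fun t j _ => ?_)
  have : ∑ c ∈ S.head j, (t • root a b).1 c = t * ∑ c ∈ S.head j, (root a b).1 c := by
    rw [Finset.mul_sum]
    rfl
  rw [zero_add, this, sum_head_root, h, sub_self, mul_zero]

/-- A plate of singlets is reduced to a parallelepiped by its own rays; any other plate has a root
as a period and is annihilated. -/
theorem PHat_le_tameFunctions : PHat n ≤ tameFunctions (allRoots n) := by
  refine Submodule.span_le.mpr ?_
  rintro _ ⟨S, rfl⟩
  by_cases h : Function.Injective S.index
  · obtain ⟨σ, hσ⟩ := S.exists_ofPerm_plate_eq h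
    change charFn S.plate ∈ _
    rw [← hσ]
    exact mem_tameFunctions_of_le (map_permRoot_le_allRoots σ)
      (isSimplicialCone_plate σ).isBoundedlySupported
  · simp only [Function.Injective, not_forall] at h
    obtain ⟨a, b, hab, hne⟩ := h
    change IsBoundedlySupported _
    rw [shiftDiffs_eq_zero_of_mem (root_mem_allRoots hne) (S.charFn_plate_sub_root hab)]
    exact IsBoundedlySupported.zero

/-- The regularized Laplace transform on the span of the plates. -/
def plateLaplace {μ : Measure (V0 n)} (hμ : IsLaplaceMeasure μ (allRoots n)) :
    PHat n →ₗ[ℂ] ((Fin n → ℝ) → ℂ) :=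
  (regLaplaceHom hμ).comp (Submodule.inclusion PHat_le_tameFunctions)

theorem plateLaplace_apply {μ : Measure (V0 n)} (hμ : IsLaplaceMeasure μ (allRoots n))
    (f : PHat n) : plateLaplace hμ f = regLaplace μ (allRoots n) f.1 := rfl

theorem plateLaplace_nonPointedPart {μ : Measure (V0 n)} (hμ : IsLaplaceMeasure μ (allRoots n))
    {f : PHat n} (hf : f ∈ nonPointedPart n) : plateLaplace hμ f = 0 := by
  have : nonPointedPart n ≤ LinearMap.ker (plateLaplace hμ) := by
    refine Submodule.span_le.mpr ?_
    rintro _ ⟨S, hS, rfl⟩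
    exact regLaplace_charFn_eq_zero S.isInequalityCone_plate hS μ
      (PHat_le_tameFunctions (plateFn S).2)
  exact this hf

theorem span_plateFn_eq_top : Submodule.span ℂ (Set.range (plateFn (n := n))) = ⊤ :=
  span_range_codRestrict_eq_top _

/-- A plate with a block of two or more labels contains a line, so modulo the non-pointed plates
only permutations remain. -/
theorem span_ofPerm_sup_nonPointedPart : Submodule.span ℂ
    (Set.range fun σ : Equiv.Perm (Fin n) => plateFn (ofPerm σ)) ⊔ nonPointedPart n = ⊤ := by
  rw [eq_top_iff, ← span_plateFn_eq_top]
  refine Submodule.span_le.mpr ?_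
  rintro _ ⟨S, rfl⟩
  by_cases h : Function.Injective S.index
  · obtain ⟨σ, hσ⟩ := S.exists_ofPerm_plate_eq h
    have : plateFn S = plateFn (ofPerm σ) := Subtype.ext (by simp [plateFn, hσ])
    rw [this]
    exact Submodule.mem_sup_left (Submodule.subset_span ⟨σ, rfl⟩)
  · simp only [Function.Injective, not_forall] at h
    obtain ⟨a, b, hab, hne⟩ := h
    exact Submodule.mem_sup_right
      (Submodule.subset_span ⟨S, S.not_isPointedCone_plate hne hab, rfl⟩)

theorem charFn_mem_nullPart {C : Set (V0 n)} (hC : charFn C ∈ PHat n)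
    (h : ¬ IsFullDimensional C) : (⟨charFn C, hC⟩ : PHat n) ∈ nullPart n := by
  have h0 : rootVolume n (Submodule.span ℝ C) = 0 := Measure.addHaar_submodule _ _ h
  change ∀ᵐ x ∂rootVolume n, charFn C x = 0
  filter_upwards [measure_eq_zero_iff_ae_notMem.mp h0] with x hx
  exact Set.indicator_of_notMem (fun hxC => hx (Submodule.subset_span hxC)) _

/-! ### Laplace transforms as rational functions -/

/-- Convergence on the whole domain comes from the cone alone. The discriminant matters only for the
value, since the regularized transform is the sum of the series where `d` does not vanish. -/
theorem isDiscreteLaplace_of_hasValues {A : Type} [CommRing A] [IsDomain A] [Algebra ℂ A]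
    {ev : (Fin n → ℝ) → A →ₐ[ℂ] ℂ} {ev' : (Fin n → ℝ) → A → ℂ} {d : A} (hd : d ≠ 0)
    (hev : ∀ y p, ev' y p = ev y p) {Λ : AddSubgroup (V0 n)} {s : Multiset (V0 n)}
    (hμ : IsLaplaceMeasure (latticeMeasure Λ) s)
    (hds : ∀ y, ev y d ≠ 0 → diffSymbol s y ≠ 0) {C : Set (V0 n)} (hC : IsInequalityCone C)
    {F : FractionRing A} (hF : HasValues ev d F (regLaplace (latticeMeasure Λ) s (charFn C))) :
    IsDiscreteLaplace ev' Λ C F := by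
  obtain ⟨p, q, hq, hpq, h⟩ := hF.exists_eq_mul hd
  refine ⟨p, q, hq, hpq, fun y hy => ?_⟩
  have hint := hC.integrable_charFn_mul_expPair hμ hy
  refine ⟨∫ v, charFn C v * expPair y v ∂latticeMeasure Λ, ?_, ?_⟩
  · have hsum := hasSum_latticeMeasure hint
    let i : {v : V0 n // v ∈ C ∧ v ∈ Λ} → Λ := fun v => ⟨v.1, v.2.2⟩
    have hi : Function.Injective i := fun v w h => Subtype.ext (congrArg (fun x : Λ => x.1) h)
    rw [← hi.hasSum_iff] at hsum
    · refine (congrArg (fun f => HasSum f _) (funext fun v => ?_)).mp hsum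
      change charFn C v.1 * expPair y v.1 = expPair y v.1
      rw [charFn, Set.indicator_of_mem v.2.1, Pi.one_apply, one_mul]
    · intro v hv
      have : v.1 ∉ C := fun hvC => hv ⟨⟨v.1, hvC, v.2⟩, rfl⟩
      simp [charFn, Set.indicator_of_notMem this]
  · rw [hev, hev]
    by_cases hdy : ev y d = 0
    · obtain ⟨h1, h2⟩ := (h y).1 hdy
      rw [h1, h2, zero_mul]
    · rw [← (h y).2 hdy, regLaplace_charFn hC hμ hy (hds y hdy)]

/-! ### Evaluation of polynomials at real points -/

/-- Evaluation of polynomials at `z_i = w(y_i)`. -/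
def evalAt (w : ℝ → ℂ) (y : Fin n → ℝ) : MvPolynomial (Fin n) ℂ →ₐ[ℂ] ℂ :=
  MvPolynomial.aeval fun i => w (y i)

theorem evalAt_apply (w : ℝ → ℂ) (y : Fin n → ℝ) (p : MvPolynomial (Fin n) ℂ) :
    evalAt w y p = MvPolynomial.eval (fun i => w (y i)) p := by
  rw [evalAt, MvPolynomial.aeval_eq_eval]

/-- The points `(w(y_i))` fill a product of infinite sets, on which only the zero polynomial
vanishes. -/
theorem eq_zero_of_evalAt {w : ℝ → ℂ} (hw : Function.Injective w) {p : MvPolynomial (Fin n) ℂ}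
    (h : ∀ y, evalAt w y p = 0) : p = 0 := by
  refine MvPolynomial.funext_set (fun _ => Set.range w) (fun _ => Set.infinite_range_of_injective hw)
    fun x hx => ?_
  choose y hy using fun i => hx i (Set.mem_univ i)
  rw [map_zero, ← h y, evalAt_apply]
  simp only [hy]

/-- The product of the differences of distinct variables. -/
def rootDiscr (n : ℕ) : MvPolynomial (Fin n) ℂ :=
  ∏ p ∈ distinctPairs n, (MvPolynomial.X p.1 - MvPolynomial.X p.2)

theorem rootDiscr_ne_zero : rootDiscr n ≠ 0 := by
  refine Finset.prod_ne_zero_iff.mpr fun p hp => sub_ne_zero.mpr fun h => ?_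
  exact (Finset.mem_filter.mp hp).2 (MvPolynomial.X_injective h)

theorem evalAt_rootDiscr_ne_zero {w : ℝ → ℂ} {y : Fin n → ℝ} :
    evalAt w y (rootDiscr n) ≠ 0 ↔ ∀ a b, a ≠ b → w (y a) ≠ w (y b) := by
  rw [rootDiscr, map_prod, Finset.prod_ne_zero_iff]
  simp [distinctPairs, evalAt, sub_ne_zero]

theorem diffSymbol_allRoots_ne_zero {w : ℝ → ℂ} {y : Fin n → ℝ}
    (h : evalAt w y (rootDiscr n) ≠ 0) : diffSymbol (allRoots n) y ≠ 0 := by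
  rw [diffSymbol_ne_zero_iff, forall_mem_allRoots]
  intro a b hab
  rw [pairing_root, sub_ne_zero]
  exact fun he => evalAt_rootDiscr_ne_zero.mp h a b hab (congrArg w he)

theorem exists_evalAt_rootDiscr_ne_zero {w : ℝ → ℂ} (hw : Function.Injective w) :
    ∃ y, evalAt w y (rootDiscr n) ≠ 0 := by
  by_contra! h
  exact rootDiscr_ne_zero (eq_zero_of_evalAt hw h)

theorem hasValues_ratVar (w : ℝ → ℂ) (i : Fin n) :
    HasValues (evalAt w) (rootDiscr n) (ratVar i) fun y => w (y i) :=
  (HasValues.of_algebraMap (MvPolynomial.X i)).congr fun y _ => by simp [evalAt]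

theorem injective_exp_neg : Function.Injective fun t : ℝ => Complex.exp (-(t : ℂ)) := by
  intro s t h
  have := congrArg norm h
  simp only [Complex.norm_exp, Complex.neg_re, Complex.ofReal_re] at this
  linarith [Real.exp_injective this]

/-! ### The representations modulo non-pointed plates -/

theorem isLaplaceMeasure_rootLattice (hn : 1 ≤ n) :
    IsLaplaceMeasure (latticeMeasure (rootLattice n)) (allRoots n) :=
  isLaplaceMeasure_latticeMeasure hn (rootLattice_le_weightLattice n)
    (forall_mem_allRoots.mpr fun a b _ => root_mem_rootLattice a b)

theorem val_lt_of_fin_pred (k : Fin (n - 1)) : (k : ℕ) < n := by omega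

theorem val_succ_lt_of_fin_pred (k : Fin (n - 1)) : (k : ℕ) + 1 < n := by omega

theorem existsUnique_discreteLaplace_PHatOne (hn : 1 ≤ n) :
    ∃! Φ : PHatOne n →ₗ[ℂ] RatField n,
      (∀ σ : Equiv.Perm (Fin n),
        Φ ((nonPointedPart n).mkQ (plateFn (OrderedSetPartition.ofPerm σ))) =
          ∏ i : Fin (n - 1),
            (1 - ratVar (σ ⟨i, val_lt_of_fin_pred i⟩) / ratVar (σ ⟨i + 1, val_succ_lt_of_fin_pred i⟩))⁻¹) ∧
      (∀ (C : Set (V0 n)) (_ : IsPolyhedralCone C) (hC : charFn C ∈ PHat n),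
        (IsPointedCone C →
          IsDiscreteLaplace evalExp (rootLattice n) C
            (Φ ((nonPointedPart n).mkQ ⟨charFn C, hC⟩))) ∧
        (¬ IsPointedCone C → Φ ((nonPointedPart n).mkQ ⟨charFn C, hC⟩) = 0)) := by
  let w : ℝ → ℂ := fun t => Complex.exp (-(t : ℂ))
  have hw : Function.Injective w := injective_exp_neg
  have hμ := isLaplaceMeasure_rootLattice hn
  have hd := exists_evalAt_rootDiscr_ne_zero (n := n) hw
  have hval : ∀ σ : Equiv.Perm (Fin n), HasValues (evalAt w) (rootDiscr n)
      (∏ i : Fin (n - 1), (1 - ratVar (σ ⟨i, val_lt_of_fin_pred i⟩) / ratVar (σ ⟨i + 1, val_succ_lt_of_fin_pred i⟩))⁻¹)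
      (plateLaplace hμ (plateFn (ofPerm σ))) := by
    intro σ
    have hexp : ∀ (k : Fin (n - 1)) y, expPair y (permRoot σ k) =
        w (y (σ ⟨k, val_lt_of_fin_pred k⟩)) * (w (y (σ ⟨k + 1, val_succ_lt_of_fin_pred k⟩)))⁻¹ := by
      intro k y
      simp only [expPair, permRoot, pairing_root, w]
      rw [← Complex.exp_neg, ← Complex.exp_add]
      congr 1
      push_cast
      ring
    refine (HasValues.prod Finset.univ fun k _ => HasValues.inv hd (HasValues.one.sub
      (((hasValues_ratVar w _).mul ((hasValues_ratVar w _).inv hd ?_)))) ?_).congr ?_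
    · exact fun y _ => Complex.exp_ne_zero _
    · intro y hy
      change 1 - w _ * (w _)⁻¹ ≠ 0
      rw [← hexp k y, sub_ne_zero, ne_comm, Ne, expPair_eq_one_iff]
      refine diffSymbol_ne_zero_iff.mp (diffSymbol_allRoots_ne_zero hy) _ ?_
      exact Multiset.mem_of_le (map_permRoot_le_allRoots σ)
        (Multiset.mem_map_of_mem _ (Finset.mem_univ k))
    · intro y hy
      rw [plateLaplace_apply]
      refine ((isSimplicialCone_plate σ).regLaplace_latticeMeasure hμ (map_permRoot_le_allRoots σ)
        (fun v hv k => exists_int_permCoord σ hv k) rfl (fun k => by simp [permCoord])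
        (diffSymbol_allRoots_ne_zero hy)).trans ?_
      rw [Finset.prod_apply]
      exact Finset.prod_congr rfl fun k _ => by rw [hexp k y]; rfl
  obtain ⟨Φ, h1, h2, h3⟩ := exists_quotient_linearMap_hasValues (plateLaplace hμ)
    (fun p hp => eq_zero_of_evalAt hw hp) rootDiscr_ne_zero span_ofPerm_sup_nonPointedPart
    (fun f hf => plateLaplace_nonPointedPart hμ hf) hval
  refine ⟨Φ, ⟨h1, fun C hpoly hC => ⟨fun _ => ?_, fun hnp => ?_⟩⟩, fun Φ' hΦ' => h2 Φ' hΦ'.1⟩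
  · exact isDiscreteLaplace_of_hasValues rootDiscr_ne_zero (fun y p => (evalAt_apply w y p).symm)
      hμ (fun y hy => diffSymbol_allRoots_ne_zero hy) hpoly.isInequalityCone (h3 ⟨charFn C, hC⟩)
  · have h4 := h3 ⟨charFn C, hC⟩
    rw [plateLaplace_apply, regLaplace_charFn_eq_zero hpoly.isInequalityCone hnp _
      (PHat_le_tameFunctions hC)] at h4
    exact h4.eq_zero (fun p hp => eq_zero_of_evalAt hw hp) rootDiscr_ne_zero

theorem existsUnique_integralLaplace_POne :
    ∃! Φ : POne n →ₗ[ℂ] RatField n,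
      (∀ σ : Equiv.Perm (Fin n),
        Φ ((nonPointedPart n ⊔ nullPart n).mkQ (plateFn (OrderedSetPartition.ofPerm σ))) =
          ∏ i : Fin (n - 1),
            (ratVar (σ ⟨i, by omega⟩) - ratVar (σ ⟨i + 1, by omega⟩))⁻¹) ∧
      (∀ (C : Set (V0 n)) (_ : IsPolyhedralCone C) (hC : charFn C ∈ PHat n),
        (IsPointedCone C →
          IsIntegralLaplace C (Φ ((nonPointedPart n ⊔ nullPart n).mkQ ⟨charFn C, hC⟩))) ∧
        (¬ IsPointedCone C →
          Φ ((nonPointedPart n ⊔ nullPart n).mkQ ⟨charFn C, hC⟩) = 0) ∧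
        (¬ IsFullDimensional C →
          Φ ((nonPointedPart n ⊔ nullPart n).mkQ ⟨charFn C, hC⟩) = 0)) := by
  let w : ℝ → ℂ := fun t => (t : ℂ)
  have hw : Function.Injective w := Complex.ofReal_injective
  have hμ := isLaplaceMeasure_rootVolume (allRoots n)
  have hd := exists_evalAt_rootDiscr_ne_zero (n := n) hw
  have hval : ∀ σ : Equiv.Perm (Fin n), HasValues (evalAt w) (rootDiscr n)
      (∏ i : Fin (n - 1), (ratVar (σ ⟨i, by omega⟩) - ratVar (σ ⟨i + 1, by omega⟩))⁻¹)
      (plateLaplace hμ (plateFn (ofPerm σ))) := by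
    intro σ
    refine (HasValues.prod Finset.univ fun k _ => HasValues.inv hd
      ((hasValues_ratVar w _).sub (hasValues_ratVar w _)) ?_).congr ?_
    · intro y hy
      refine sub_ne_zero.mpr (evalAt_rootDiscr_ne_zero.mp hy _ _ fun h => ?_)
      have := congrArg Fin.val (σ.injective h)
      simp at this
    · intro y hy
      rw [plateLaplace_apply]
      refine (regLaplace_rootVolume σ (map_permRoot_le_allRoots σ)
        (diffSymbol_allRoots_ne_zero hy)).trans ?_
      rw [Finset.prod_apply]
      refine Finset.prod_congr rfl fun k _ => ?_
      rw [permRoot, pairing_root, Complex.ofReal_sub]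
      rfl
  obtain ⟨Φ, h1, h2, h3⟩ := exists_quotient_linearMap_hasValues
    (N := nonPointedPart n ⊔ nullPart n) (plateLaplace hμ)
    (fun p hp => eq_zero_of_evalAt hw hp) rootDiscr_ne_zero
    (by rw [← sup_assoc, span_ofPerm_sup_nonPointedPart, top_sup_eq])
    -- The non-pointed summand dies by periodicity, the null summand because the measure is Lebesgue
    -- measure.
    (fun f hf => by
      obtain ⟨g, hg, k, hk, rfl⟩ := Submodule.mem_sup.mp hf
      rw [map_add, plateLaplace_nonPointedPart hμ hg, zero_add, plateLaplace_apply]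
      exact regLaplace_congr_ae hμ hk) hval
  refine ⟨Φ, ⟨h1, fun C hpoly hC => ⟨fun _ => ?_, fun hnp => ?_, fun hfd => ?_⟩⟩,
    fun Φ' hΦ' => h2 Φ' hΦ'.1⟩
  · obtain ⟨p, q, hq, hpq, h⟩ := (h3 ⟨charFn C, hC⟩).exists_eq_mul rootDiscr_ne_zero
    have hcone := hpoly.isInequalityCone
    have hfun : ∀ y, (fun v => charFn C v * expPair y v) =
        C.indicator fun v => Complex.exp (-(pairing y v : ℂ)) := fun y => by
      funext v
      by_cases hv : v ∈ C <;> simp [charFn, expPair, hv]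
    refine ⟨p, q, hq, hpq, fun y hy => ?_⟩
    have hint := hcone.integrable_charFn_mul_expPair hμ hy
    have hCm := hcone.isClosed.measurableSet
    refine ⟨by rwa [hfun, integrable_indicator_iff hCm] at hint, ?_⟩
    rw [← integral_indicator hCm, ← hfun]
    change MvPolynomial.eval (fun i => w (y i)) q * _ = MvPolynomial.eval (fun i => w (y i)) p
    rw [← evalAt_apply, ← evalAt_apply]
    by_cases hdy : evalAt w y (rootDiscr n) = 0
    · obtain ⟨h4, h5⟩ := (h y).1 hdy
      rw [h4, h5, zero_mul]
    · rw [← (h y).2 hdy, plateLaplace_apply,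
        regLaplace_charFn hcone hμ hy (diffSymbol_allRoots_ne_zero hdy)]
  · have h4 := h3 ⟨charFn C, hC⟩
    rw [plateLaplace_apply, regLaplace_charFn_eq_zero hpoly.isInequalityCone hnp _
      (PHat_le_tameFunctions hC)] at h4
    exact h4.eq_zero (fun p hp => eq_zero_of_evalAt hw hp) rootDiscr_ne_zero
  · have h4 : (nonPointedPart n ⊔ nullPart n).mkQ ⟨charFn C, hC⟩ = 0 :=
      (Submodule.Quotient.mk_eq_zero _).mpr (Submodule.mem_sup_right (charFn_mem_nullPart hC hfd))
    rw [h4, map_zero]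

/-! ### Duality on the span of the plates -/

/-- The subsets other than the empty set and the set of all labels. -/
def properSubsets (n : ℕ) : Finset (Finset (Fin n)) := {I | I ≠ ∅ ∧ I ≠ Finset.univ}

/-- The vectors `ē_I` for the proper nonempty subsets `I`. -/
def allWeights (n : ℕ) : Multiset (V0 n) := (properSubsets n).val.map ebar

theorem mem_properSubsets {I : Finset (Fin n)} :
    I ∈ properSubsets n ↔ I ≠ ∅ ∧ I ≠ Finset.univ := by
  simp [properSubsets]

theorem ebar_mem_allWeights {I : Finset (Fin n)} (hI : I ∈ properSubsets n) :
    ebar I ∈ allWeights n := Multiset.mem_map_of_mem _ hI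

theorem ebar_ne_zero {I : Finset (Fin n)} (hI : I ∈ properSubsets n) : ebar I ≠ 0 := by
  obtain ⟨h1, h2⟩ := mem_properSubsets.mp hI
  obtain ⟨a, ha⟩ := Finset.nonempty_iff_ne_empty.mpr h1
  obtain ⟨b, hb⟩ : ∃ b, b ∉ I := by
    by_contra! h
    exact h2 (Finset.eq_univ_iff_forall.mpr h)
  intro h
  have h3 := congrFun (congrArg Subtype.val h) a
  have h4 := congrFun (congrArg Subtype.val h) b
  simp only [ebar, ha, hb, if_true, if_false, ZeroMemClass.coe_zero, Pi.zero_apply] at h3 h4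
  linarith

theorem head_mem_properSubsets (S : OrderedSetPartition n) (k : Fin (S.len - 1)) :
    S.head (k + 1) ∈ properSubsets n := mem_properSubsets.mpr (S.dualRay_ne k)

theorem map_dualRay_le_allWeights (S : OrderedSetPartition n) :
    Finset.univ.val.map S.dualRay ≤ allWeights n := by
  let e : Fin (S.len - 1) ↪ Finset (Fin n) := ⟨_, S.head_injective⟩
  have h1 : Finset.univ.val.map S.dualRay = (Finset.univ.map e).val.map ebar := by
    rw [Finset.map_val, Multiset.map_map]
    rfl
  rw [h1]
  refine Multiset.map_le_map (Finset.val_le_iff.mpr fun p hp => ?_)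
  obtain ⟨k, -, rfl⟩ := Finset.mem_map.mp hp
  exact head_mem_properSubsets S k

theorem PHat_le_coneSpan : PHat n ≤ coneSpan n := by
  refine Submodule.span_mono ?_
  rintro _ ⟨S, rfl⟩
  exact ⟨⟨S.plate, S.isInequalityCone_plate⟩, rfl⟩

/-- Duality on the span of the plates. -/
def plateDual (n : ℕ) : PHat n →ₗ[ℂ] (V0 n → ℂ) :=
  (dualMap n).comp (Submodule.inclusion PHat_le_coneSpan)

theorem plateDual_charFn {C : Set (V0 n)} (hC : IsInequalityCone C) (h : charFn C ∈ PHat n) :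
    plateDual n ⟨charFn C, h⟩ = charFn (dualConeV0 C) := dualMap_coneFn ⟨C, hC⟩

theorem plateDual_plateFn (S : OrderedSetPartition n) :
    plateDual n (plateFn S) = charFn (dualConeV0 S.plate) :=
  plateDual_charFn S.isInequalityCone_plate _

theorem plateDual_mem_tameFunctions (f : PHat n) : plateDual n f ∈ tameFunctions (allWeights n) := by
  have : (⊤ : Submodule ℂ (PHat n)) ≤ (tameFunctions (allWeights n)).comap (plateDual n) := by
    rw [← span_plateFn_eq_top]
    refine Submodule.span_le.mpr ?_
    rintro _ ⟨S, rfl⟩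
    change plateDual n (plateFn S) ∈ tameFunctions (allWeights n)
    rw [plateDual_plateFn]
    exact mem_tameFunctions_of_le (map_dualRay_le_allWeights S)
      S.isSimplicialCone_dual_plate.isBoundedlySupported
  exact this Submodule.mem_top

/-- For a cone `C` and the hyperplane `H` where `∑_{a ∈ I} x_a = 0`, the vector `ē_I` is orthogonal
to `C ∩ H`. So the dual of `C ∩ H` has period `ē_I` and its differences vanish. Linearity extends
this to the span. -/
theorem dualMap_inter_hyperplane {I : Finset (Fin n)} (hI : I ∈ properSubsets n) (f : coneSpan n) :
    ∃ g : coneSpan n, (∀ x, g.1 x = f.1 x * if ∑ a ∈ I, x.1 a = 0 then 1 else 0) ∧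
      shiftDiffs (allWeights n) (dualMap n g) = 0 := by
  classical
  have hf : f ∈ Submodule.span ℂ (Set.range (coneFn (n := n))) := by
    have : Submodule.span ℂ (Set.range (coneFn (n := n))) = ⊤ := span_range_codRestrict_eq_top _
    rw [this]
    exact Submodule.mem_top
  induction hf using Submodule.span_induction with
  | mem f hf =>
    obtain ⟨C, rfl⟩ := hf
    let H : Set (V0 n) := {x | ∑ a ∈ I, x.1 a = 0}
    have hH : IsInequalityCone H := by
      refine ⟨{fun a => if a ∈ I then 1 else 0, -fun a => if a ∈ I then 1 else 0}, ?_⟩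
      ext x
      have : pairing (-fun a => if a ∈ I then (1 : ℝ) else 0) x = -∑ a ∈ I, x.1 a := by
        rw [← pairing_indicator]
        simp [pairing]
      change _ ↔ ∀ a ∈ ({_, _} : Set (Fin n → ℝ)), _
      simp only [Set.mem_insert_iff, Set.mem_singleton_iff, forall_eq_or_imp, forall_eq,
        pairing_indicator, this]
      exact ⟨fun h => ⟨h.ge, by rw [show ∑ a ∈ I, x.1 a = 0 from h, neg_zero]⟩,
        fun h => le_antisymm (by linarith [h.2]) h.1⟩
    refine ⟨coneFn ⟨C.1 ∩ H, C.2.inter hH⟩, fun x => ?_, ?_⟩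
    · by_cases h1 : x ∈ C.1 <;> by_cases h2 : ∑ a ∈ I, x.1 a = 0 <;>
        simp [coneFn, charFn, H, h1, h2]
    · rw [dualMap_coneFn]
      refine shiftDiffs_eq_zero_of_mem (ebar_mem_allWeights hI) fun v => ?_
      have : v - ebar I ∈ dualConeV0 (C.1 ∩ H) ↔ v ∈ dualConeV0 (C.1 ∩ H) := by
        refine forall₂_congr fun x hx => ?_
        have h0 : pairing x.1 (ebar I) = 0 := by
          rw [pairing_comm, pairing_ebar]
          exact hx.2
        rw [pairing_comm, pairing_sub_right, h0, sub_zero, pairing_comm]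
      simp only [charFn, Set.indicator_apply, this, Pi.one_apply]
  | zero => exact ⟨0, fun x => by simp, by rw [map_zero, shiftDiffs_zero_fun]⟩
  | add f f' _ _ ih ih' =>
    obtain ⟨g, h1, h2⟩ := ih
    obtain ⟨g', h1', h2'⟩ := ih'
    refine ⟨g + g', fun x => ?_, ?_⟩
    · simp only [Submodule.coe_add, Pi.add_apply, h1, h1', add_mul]
    · rw [map_add, shiftDiffs_add, h2, h2', add_zero]
  | smul c f _ ih =>
    obtain ⟨g, h1, h2⟩ := ih
    refine ⟨c • g, fun x => ?_, ?_⟩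
    · simp only [Submodule.coe_smul, Pi.smul_apply, smul_eq_mul, h1, mul_assoc]
    · rw [map_smul, shiftDiffs_smul, h2, smul_zero]

/-- Removing the hyperplanes one at a time from the support of a function changes its dual only by
terms that the differences annihilate. -/
theorem shiftDiffs_dualMap_eq_of_subset (F : Finset (Finset (Fin n))) (hF : F ⊆ properSubsets n)
    (f : coneSpan n) : ∃ g : coneSpan n,
      (∀ x, g.1 x = f.1 x * ∏ I ∈ F, (1 - if ∑ a ∈ I, x.1 a = 0 then 1 else 0)) ∧
      shiftDiffs (allWeights n) (dualMap n g) = shiftDiffs (allWeights n) (dualMap n f) := by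
  induction F using Finset.cons_induction with
  | empty => exact ⟨f, fun x => by simp, rfl⟩
  | cons I F hI ih =>
    obtain ⟨g, h1, h2⟩ := ih fun J hJ => hF (Finset.mem_cons_of_mem hJ)
    obtain ⟨k, h3, h4⟩ := dualMap_inter_hyperplane (hF (Finset.mem_cons_self I F)) g
    refine ⟨g + (-1 : ℂ) • k, fun x => ?_, ?_⟩
    · simp only [Submodule.coe_add, Submodule.coe_smul, Pi.add_apply, Pi.smul_apply, smul_eq_mul,
        h3, h1, Finset.prod_cons]
      ring
    · rw [map_add, map_smul, shiftDiffs_add, shiftDiffs_smul, h4, h2, smul_zero, add_zero]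

/-- Off the hyperplanes every defining sum of a plate is strictly positive or strictly negative, and
this persists nearby. -/
theorem eventually_charFn_plate_eq (S : OrderedSetPartition n) {x : V0 n}
    (hx : ∀ I ∈ properSubsets n, ∑ a ∈ I, x.1 a ≠ 0) :
    ∀ᶠ z in nhds x, charFn S.plate z = charFn S.plate x := by
  classical
  have h : ∀ k : Fin (S.len - 1), ∀ᶠ z : V0 n in nhds x,
      (0 ≤ ∑ a ∈ S.head (k + 1), z.1 a ↔ 0 ≤ ∑ a ∈ S.head (k + 1), x.1 a) := by
    intro k
    have hc : ContinuousAt (fun z : V0 n => ∑ a ∈ S.head (k + 1), z.1 a) x := by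
      simp only [← pairing_indicator]
      exact (continuous_pairing _).continuousAt
    rcases (hx _ (head_mem_properSubsets S k)).lt_or_gt with h0 | h0
    · filter_upwards [hc.eventually_lt_const h0] with z hz
      exact iff_of_false (not_le.mpr hz) (not_le.mpr h0)
    · filter_upwards [hc.eventually_const_lt h0] with z hz
      exact iff_of_true hz.le h0.le
  filter_upwards [Filter.eventually_all.mpr h] with z hz
  have : z ∈ S.plate ↔ x ∈ S.plate := by
    rw [S.mem_plate_iff, S.mem_plate_iff]
    exact forall_congr' hz
  simp only [charFn, Set.indicator_apply, this, Pi.one_apply]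

/-- Off the hyperplanes `f` is locally constant, so a nonzero value would be taken on a
neighbourhood, which has positive measure. -/
theorem apply_eq_zero_of_mem_nullPart {f : PHat n} (hf : f ∈ nullPart n) {x : V0 n}
    (hx : ∀ I ∈ properSubsets n, ∑ a ∈ I, x.1 a ≠ 0) : f.1 x = 0 := by
  have h : ∀ᶠ z in nhds x, f.1 z = f.1 x := by
    obtain ⟨f, hf'⟩ := f
    clear hf
    change ∀ᶠ z in nhds x, f z = f x
    induction hf' using Submodule.span_induction with
    | mem f hf =>
      obtain ⟨S, rfl⟩ := hf
      exact eventually_charFn_plate_eq S hx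
    | zero => exact Filter.Eventually.of_forall fun _ => rfl
    | add f g _ _ ih ih' =>
      filter_upwards [ih, ih'] with z h1 h2
      simp [h1, h2]
    | smul c f _ ih =>
      filter_upwards [ih] with z h1
      simp [h1]
  by_contra hne
  have h1 : 0 < rootVolume n {z | f.1 z = f.1 x} := Measure.measure_pos_of_mem_nhds _ h
  have h2 : rootVolume n {z | ¬ f.1 z = 0} = 0 := ae_iff.mp hf
  refine h1.ne' (measure_mono_null (fun z hz => ?_) h2)
  change ¬ f.1 z = 0
  rwa [show f.1 z = f.1 x from hz]

/-- A null element is supported on the hyperplanes; removing them all leaves zero, without affecting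
the differences of the dual. -/
theorem shiftDiffs_plateDual_nullPart {f : PHat n} (hf : f ∈ nullPart n) :
    shiftDiffs (allWeights n) (plateDual n f) = 0 := by
  obtain ⟨g, h1, h2⟩ := shiftDiffs_dualMap_eq_of_subset (properSubsets n) subset_rfl
    (Submodule.inclusion PHat_le_coneSpan f)
  have hg : g = 0 := by
    refine Subtype.ext (funext fun x => ?_)
    rw [h1]
    by_cases hx : ∀ I ∈ properSubsets n, ∑ a ∈ I, x.1 a ≠ 0
    · rw [Submodule.coe_inclusion, apply_eq_zero_of_mem_nullPart hf hx, zero_mul]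
      rfl
    · push Not at hx
      obtain ⟨I, hI, h0⟩ := hx
      rw [Finset.prod_eq_zero hI (by simp [h0]), mul_zero]
      rfl
  rw [plateDual, LinearMap.comp_apply, ← h2, hg, map_zero, shiftDiffs_zero_fun]

/-- The regularized Laplace transform of the duals. -/
def dualLaplace {μ : Measure (V0 n)} (hμ : IsLaplaceMeasure μ (allWeights n)) :
    PHat n →ₗ[ℂ] ((Fin n → ℝ) → ℂ) :=
  (regLaplaceHom hμ).comp ((plateDual n).codRestrict _ plateDual_mem_tameFunctions)

theorem dualLaplace_apply {μ : Measure (V0 n)} (hμ : IsLaplaceMeasure μ (allWeights n))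
    (f : PHat n) : dualLaplace hμ f = regLaplace μ (allWeights n) (plateDual n f) := rfl

/-! ### The weight algebra -/

/-- The exponential `v ↦ e^{-⟨y, v⟩}` as a character of the weight lattice. -/
def weightCharacter (y : Fin n → ℝ) : Multiplicative (weightLattice n) →* ℂ where
  toFun v := expPair y v.toAdd.1
  map_one' := by simp [expPair, pairing]
  map_mul' v w := expPair_add y _ _

/-- Evaluation of a combination of exponentials, as an algebra homomorphism. -/
def evalWeightHom (y : Fin n → ℝ) : WeightAlgebra n →ₐ[ℂ] ℂ :=
  AddMonoidAlgebra.lift ℂ ℂ (weightLattice n) (weightCharacter y)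

theorem evalWeightHom_apply (y : Fin n → ℝ) (p : WeightAlgebra n) :
    evalWeight y p = evalWeightHom y p := by
  rw [evalWeightHom, AddMonoidAlgebra.lift_apply]
  rfl

theorem evalWeightHom_single (y : Fin n → ℝ) (v : weightLattice n) :
    evalWeightHom y (AddMonoidAlgebra.single v 1) = expPair y v.1 := by
  rw [evalWeightHom, AddMonoidAlgebra.lift_single, one_smul]
  rfl

/-- Distinct weights give distinct characters `y ↦ e^{-⟨y, v⟩}` of the additive group `ℝ^n`, and
distinct characters are linearly independent. -/
theorem eq_zero_of_evalWeightHom {p : WeightAlgebra n} (h : ∀ y, evalWeightHom y p = 0) :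
    p = 0 := by
  let χ : weightLattice n → (Multiplicative (Fin n → ℝ) →* ℂ) := fun v =>
    { toFun := fun y => expPair y.toAdd v.1
      map_one' := by simp [expPair, pairing]
      map_mul' := fun y z => by
        simp only [expPair, ← Complex.exp_add, toAdd_mul]
        congr 1
        simp only [pairing, Pi.add_apply, add_mul, Finset.sum_add_distrib]
        push_cast
        ring }
  have hχ : Function.Injective χ := by
    intro v w hvw
    refine Subtype.ext (Subtype.ext (funext fun a => ?_))
    have h1 := congrArg norm
      (DFunLike.congr_fun hvw (Multiplicative.ofAdd (Pi.single a 1)))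
    have h2 : ∀ u : V0 n, pairing (Pi.single a 1) u = u.1 a := fun u => by
      simp [pairing, Pi.single_apply]
    change ‖expPair (Pi.single a 1) v.1‖ = ‖expPair (Pi.single a 1) w.1‖ at h1
    rw [norm_expPair, norm_expPair, h2, h2] at h1
    linarith [Real.exp_injective h1]
  have hli := (linearIndependent_monoidHom (Multiplicative (Fin n → ℝ)) ℂ).comp χ hχ
  have h3 : p.coeff = 0 := by
    refine linearIndependent_iff.mp hli p.coeff (funext fun y => ?_)
    rw [Finsupp.linearCombination_apply, Finsupp.sum, Finset.sum_apply, Pi.zero_apply,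
      ← h y.toAdd, ← evalWeightHom_apply]
    rfl
  ext v
  rw [h3]
  rfl

/-- The product of the `1 - e^{-⟨y, ē_I⟩}` over the proper nonempty subsets `I`. -/
def weightDiscr (n : ℕ) : WeightAlgebra n :=
  ∏ I ∈ properSubsets n, (1 - AddMonoidAlgebra.single (ebarWeight I) 1)

theorem evalWeightHom_weightDiscr (y : Fin n → ℝ) :
    evalWeightHom y (weightDiscr n) = diffSymbol (allWeights n) y := by
  rw [weightDiscr, map_prod, diffSymbol, allWeights, Multiset.map_map]
  refine Finset.prod_congr rfl fun I _ => ?_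
  rw [map_sub, map_one, evalWeightHom_single]
  rfl

theorem weightDiscr_ne_zero : weightDiscr n ≠ 0 := by
  refine Finset.prod_ne_zero_iff.mpr fun I hI h => ?_
  -- At `y = ē_I` the exponent is `-|ē_I|²`, which would have to vanish.
  have h1 := congrArg (fun p => evalWeightHom (ebar I).1 p) h
  simp only [map_sub, map_one, evalWeightHom_single, map_zero, sub_eq_zero] at h1
  have h2 := (expPair_eq_one_iff _ _).mp h1.symm
  refine ebar_ne_zero hI (Subtype.ext (funext fun a => ?_))
  have h3 := (Finset.sum_eq_zero_iff_of_nonneg fun i _ => mul_self_nonneg _).mp h2 a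
    (Finset.mem_univ a)
  exact mul_self_eq_zero.mp h3

/-! ### The representation modulo lower-dimensional cones -/

theorem isLaplaceMeasure_weightLattice (hn : 1 ≤ n) :
    IsLaplaceMeasure (latticeMeasure (weightLattice n)) (allWeights n) := by
  refine isLaplaceMeasure_latticeMeasure hn le_rfl fun r hr => ?_
  obtain ⟨I, -, rfl⟩ := Multiset.mem_map.mp hr
  exact ebar_mem_weightLattice I

theorem existsUnique_discreteLaplace_P (hn : 1 ≤ n) :
    ∃! Φ : P n →ₗ[ℂ] WeightField n,
      (∀ S : OrderedSetPartition n,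
        Φ ((nullPart n).mkQ (plateFn S)) =
          ∏ j ∈ Finset.Ico 1 S.len, (1 - weightExp (ebarWeight (S.head j)))⁻¹) ∧
      (∀ (C : Set (V0 n)) (_ : IsPolyhedralCone C) (hC : charFn C ∈ PHat n),
        (IsPointedCone (dualConeV0 C) →
          IsDiscreteLaplace evalWeight (weightLattice n) (dualConeV0 C)
            (Φ ((nullPart n).mkQ ⟨charFn C, hC⟩))) ∧
        (¬ IsPointedCone (dualConeV0 C) → Φ ((nullPart n).mkQ ⟨charFn C, hC⟩) = 0) ∧
        (¬ IsFullDimensional C → Φ ((nullPart n).mkQ ⟨charFn C, hC⟩) = 0)) := by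
  have hμ := isLaplaceMeasure_weightLattice hn
  have hd : ∃ y, evalWeightHom y (weightDiscr n) ≠ 0 := by
    by_contra! h
    exact weightDiscr_ne_zero (eq_zero_of_evalWeightHom h)
  have hds : ∀ y : Fin n → ℝ, evalWeightHom y (weightDiscr n) ≠ 0 →
      diffSymbol (allWeights n) y ≠ 0 := fun y hy => by rwa [← evalWeightHom_weightDiscr]
  have hval : ∀ S : OrderedSetPartition n, HasValues evalWeightHom (weightDiscr n)
      (∏ j ∈ Finset.Ico 1 S.len, (1 - weightExp (ebarWeight (S.head j)))⁻¹)
      (dualLaplace hμ (plateFn S)) := by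
    intro S
    -- The ray of index `k` belongs to the head of length `j = k + 1`.
    have hIco : ∏ j ∈ Finset.Ico 1 S.len, (1 - weightExp (ebarWeight (S.head j)))⁻¹ =
        ∏ k : Fin (S.len - 1), (1 - weightExp (ebarWeight (S.head (k + 1))))⁻¹ := by
      rw [Finset.prod_Ico_eq_prod_range, Finset.prod_range]
      simp only [add_comm 1]
    rw [hIco]
    refine (HasValues.prod Finset.univ fun k _ => HasValues.inv hd (HasValues.one.sub
      (HasValues.of_algebraMap _)) ?_).congr ?_
    · intro y hy
      change 1 - evalWeightHom y _ ≠ 0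
      rw [evalWeightHom_single, sub_ne_zero, ne_comm, Ne, expPair_eq_one_iff]
      exact diffSymbol_ne_zero_iff.mp (hds y hy) _
        (ebar_mem_allWeights (head_mem_properSubsets S k))
    · intro y hy
      rw [dualLaplace_apply, plateDual_plateFn]
      refine (S.isSimplicialCone_dual_plate.regLaplace_latticeMeasure hμ
        (map_dualRay_le_allWeights S) (fun v hv k => S.exists_int_dualCoord hv k) ?_ (fun k => ?_)
        (hds y hy)).trans ?_
      · have h0 : (0 : V0 n) ∈ S.blockConstant := fun _ _ _ => rfl
        exact Set.indicator_of_mem h0 _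
      · simp [dualCoord, blockValue]
      · rw [Finset.prod_apply]
        refine Finset.prod_congr rfl fun k _ => ?_
        simp only [Pi.inv_apply, Pi.sub_apply, Pi.one_apply, evalWeightHom_single]
        rfl
  obtain ⟨Φ, h1, h2, h3⟩ := exists_quotient_linearMap_hasValues (N := nullPart n) (dualLaplace hμ)
    (fun p hp => eq_zero_of_evalWeightHom hp) weightDiscr_ne_zero
    (by rw [span_plateFn_eq_top, top_sup_eq])
    (fun f hf => regLaplace_eq_zero_of_shiftDiffs (shiftDiffs_plateDual_nullPart hf)) hval
  refine ⟨Φ, ⟨h1, fun C hpoly hC => ?_⟩, fun Φ' hΦ' => h2 Φ' hΦ'.1⟩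
  have hcone := IsInequalityCone.dual C
  have hdual := plateDual_charFn hpoly.isInequalityCone hC
  have h4 := h3 ⟨charFn C, hC⟩
  rw [dualLaplace_apply, hdual] at h4
  refine ⟨fun _ => ?_, fun hnp => ?_, fun hfd => ?_⟩
  · exact isDiscreteLaplace_of_hasValues weightDiscr_ne_zero evalWeightHom_apply hμ hds hcone h4
  · rw [regLaplace_charFn_eq_zero hcone hnp _
      (hdual ▸ plateDual_mem_tameFunctions ⟨charFn C, hC⟩)] at h4
    exact h4.eq_zero (fun p hp => eq_zero_of_evalWeightHom hp) weightDiscr_ne_zero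
  · have h5 : (nullPart n).mkQ ⟨charFn C, hC⟩ = 0 :=
      (Submodule.Quotient.mk_eq_zero _).mpr (charFn_mem_nullPart hC hfd)
    rw [h5, map_zero]

theorem propositionA2 (n : ℕ) (hn : 1 ≤ n) :
    (∃! Φ : P n →ₗ[ℂ] WeightField n,
      (∀ S : OrderedSetPartition n,
        Φ ((nullPart n).mkQ (plateFn S)) =
          ∏ j ∈ Finset.Ico 1 S.len, (1 - weightExp (ebarWeight (S.head j)))⁻¹) ∧
      (∀ (C : Set (V0 n)) (_ : IsPolyhedralCone C) (hC : charFn C ∈ PHat n),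
        (IsPointedCone (dualConeV0 C) →
          IsDiscreteLaplace evalWeight (weightLattice n) (dualConeV0 C)
            (Φ ((nullPart n).mkQ ⟨charFn C, hC⟩))) ∧
        (¬ IsPointedCone (dualConeV0 C) → Φ ((nullPart n).mkQ ⟨charFn C, hC⟩) = 0) ∧
        (¬ IsFullDimensional C → Φ ((nullPart n).mkQ ⟨charFn C, hC⟩) = 0))) ∧
    (∃! Φ : PHatOne n →ₗ[ℂ] RatField n,
      (∀ σ : Equiv.Perm (Fin n),
        Φ ((nonPointedPart n).mkQ (plateFn (OrderedSetPartition.ofPerm σ))) =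
          ∏ i : Fin (n - 1),
            (1 - ratVar (σ ⟨i, by omega⟩) / ratVar (σ ⟨i + 1, by omega⟩))⁻¹) ∧
      (∀ (C : Set (V0 n)) (_ : IsPolyhedralCone C) (hC : charFn C ∈ PHat n),
        (IsPointedCone C →
          IsDiscreteLaplace evalExp (rootLattice n) C
            (Φ ((nonPointedPart n).mkQ ⟨charFn C, hC⟩))) ∧
        (¬ IsPointedCone C → Φ ((nonPointedPart n).mkQ ⟨charFn C, hC⟩) = 0))) ∧
    (∃! Φ : POne n →ₗ[ℂ] RatField n,
      (∀ σ : Equiv.Perm (Fin n),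
        Φ ((nonPointedPart n ⊔ nullPart n).mkQ (plateFn (OrderedSetPartition.ofPerm σ))) =
          ∏ i : Fin (n - 1),
            (ratVar (σ ⟨i, by omega⟩) - ratVar (σ ⟨i + 1, by omega⟩))⁻¹) ∧
      (∀ (C : Set (V0 n)) (_ : IsPolyhedralCone C) (hC : charFn C ∈ PHat n),
        (IsPointedCone C →
          IsIntegralLaplace C (Φ ((nonPointedPart n ⊔ nullPart n).mkQ ⟨charFn C, hC⟩))) ∧
        (¬ IsPointedCone C →
          Φ ((nonPointedPart n ⊔ nullPart n).mkQ ⟨charFn C, hC⟩) = 0) ∧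
        (¬ IsFullDimensional C →
          Φ ((nonPointedPart n ⊔ nullPart n).mkQ ⟨charFn C, hC⟩) = 0))) :=
  ⟨existsUnique_discreteLaplace_P hn, existsUnique_discreteLaplace_PHatOne hn,
    existsUnique_integralLaplace_POne⟩

end
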